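/- Let $E$ be a Polish space with its Borel $\sigma$-algebra, let $(X_t,(\mathbb P_x)_{x\in E})_{t\ge 0}$ be a conservative (jointly measurable) time-homogeneous Markov process on $E$ with semigroup $P_tf(x)=\mathbb E_x[f(X_t)]$, let $\mu$ be an invariant probability measure, and let $\mathbb P_\mu=\int \mathbb P_x\,\mu(dx)$ be the law of the stationary process. Assume that there is a non-increasing function $\eta:[0,\infty)\to[0,\infty)$ such that $$\mathrm{Var}_\mu(P_tf)\le \eta(t)\,\Big\|f-\int f\,d\mu\Big\|_\infty^2\qquad\text{for all bounded measurable } f \text{ and all } t\ge 0 .$$ Let $\alpha:[0,\infty)\to\mathbb R$ be one of the following functions: (a) the strong mixing coefficient of the stationary process, $\alpha(r)=\sup_{s,F,G}|\mathrm{Cov}_{\mathbb P_\mu}(F,G)|$, where $s\ge 0$, $F$ is $\sigma(X_u,u\le s)$-measurable, $G$ is $\sigma(X_u,u\ge s+r)$-measurable, and both take values in $[0,1]$; (b) its upper bound $\alpha(r)=\sqrt{\eta(r)}$; (c) if $\mu$ is moreover symmetric (reversible) for $(P_t)$, its upper bound $\alpha(r)=\eta(r/2)$. Let $k\ge 2$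 be an integer such that $M_k(\alpha):=\sup_{r\ge 0}(1+r)^k\alpha(r)<\infty$. Then there is a constant $C(k)>0$, depending only on $k$, such that for all measurable $V:E\to\mathbb R$ with $\sup|V|=1$, all $0<R\le 1$ and all $t>0$ with $t(1-R)<[t]$, where $[t]$ denotes the integer part of $t$, $$\mathbb P_\mu\left(\frac1t\int_0^tV(X_s)\,ds-\int V\,d\mu\ \ge\ R\right)\ \le\ \frac{C(k)\,M_k(\alpha)}{t^k\,\big(R-(1-[t]/t)\big)^{2k}} .$$ -/

import Mathlib

open MeasureTheory ProbabilityTheory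
open scoped NNReal ENNReal

/-- The past `σ(X_u, u ≤ s)` of a process. -/
abbrev pastSigma {Ω E : Type*} [MeasurableSpace E] (X : ℝ≥0 → Ω → E) (s : ℝ≥0) :
    MeasurableSpace Ω :=
  ⨆ u : Set.Iic s, MeasurableSpace.comap (X u) inferInstance

/-- The future `σ(X_u, u ≥ s)` of a process. -/
abbrev futureSigma {Ω E : Type*} [MeasurableSpace E] (X : ℝ≥0 → Ω → E) (s : ℝ≥0) :
    MeasurableSpace Ω :=
  ⨆ u : Set.Ici s, MeasurableSpace.comap (X u) inferInstance

/-- A conservative time-homogeneous Markov process `(X_t, (P_x)_{x ∈ E})` with continuous time and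
jointly measurable paths. -/
structure MarkovProcess (Ω E : Type*) [MeasurableSpace Ω] [MeasurableSpace E] where
  /-- the process -/
  X : ℝ≥0 → Ω → E
  /-- the law `P_x` of the process started at `x` -/
  law : Kernel E Ω
  isMarkovKernel_law : IsMarkovKernel law
  measurable_uncurry : Measurable (fun p : ℝ≥0 × Ω => X p.1 p.2)
  start : ∀ x : E, ∀ᵐ ω ∂(law x), X 0 ω = x
  /-- the simple Markov property
  `P_x(A ∩ {X_{s+t} ∈ B}) = E_x[1_A P_{X_s}(X_t ∈ B)]` for `A` in the past of time `s` -/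
  markov : ∀ (x : E) (s t : ℝ≥0) (A : Set Ω) (B : Set E),
    MeasurableSet[pastSigma X s] A → MeasurableSet B →
      law x (A ∩ X (s + t) ⁻¹' B) = ∫⁻ ω in A, (law (X s ω)).map (X t) B ∂(law x)

namespace MarkovProcess

variable {Ω E : Type*} [MeasurableSpace Ω] [MeasurableSpace E]

/-- The transition kernel `P_t(x, ·)`, the law of `X_t` under `P_x`. -/
noncomputable def transition (Y : MarkovProcess Ω E) (t : ℝ≥0) : Kernel E E :=
  Y.law.map (Y.X t)

/-- The semigroup `P_t f (x) = E_x[f(X_t)]`. -/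
noncomputable def semigroup (Y : MarkovProcess Ω E) (t : ℝ≥0) (f : E → ℝ) (x : E) : ℝ :=
  ∫ y, f y ∂(Y.transition t x)

/-- The law `P_μ = ∫ P_x μ(dx)` of the process with initial distribution `μ`. -/
noncomputable def lawFrom (Y : MarkovProcess Ω E) (μ : Measure E) : Measure Ω :=
  μ.bind Y.law

/-- `μ` is an invariant measure of the semigroup. -/
def IsInvariant (Y : MarkovProcess Ω E) (μ : Measure E) : Prop :=
  ∀ t, (Y.transition t).Invariant μ

/-- `μ` is symmetric (reversible) for the semigroup. -/
def IsSymmetric (Y : MarkovProcess Ω E) (μ : Measure E) : Prop :=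
  ∀ t, (Y.transition t).IsReversible μ

/-- The decay property: `η` is nonincreasing on `[0, ∞)` and
`Var_μ(P_t f) ≤ η(t) ‖f - ∫ f dμ‖_∞²` for all bounded measurable `f` and all `t ≥ 0`. -/
def Decay (Y : MarkovProcess Ω E) (μ : Measure E) (η : ℝ≥0 → ℝ≥0) : Prop :=
  Antitone η ∧
    ∀ f : E → ℝ, Measurable f → (∃ c : ℝ, ∀ x, |f x| ≤ c) → ∀ t : ℝ≥0,
      variance (Y.semigroup t f) μ ≤ (η t : ℝ) * (⨆ x, |f x - ∫ y, f y ∂μ|) ^ 2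

end MarkovProcess

/-- The strong mixing coefficient of a process: `α(r)` is the supremum of `|Cov(F, G)|` over all
`s ≥ 0` and all `[0, 1]`-valued `F`, `G` that are measurable for the past of time `s` and for the
future of time `s + r`, respectively. -/
noncomputable def strongMixing {Ω E : Type*} [MeasurableSpace Ω] [MeasurableSpace E]
    (X : ℝ≥0 → Ω → E) (P : Measure Ω) (r : ℝ≥0) : ℝ :=
  sSup {c : ℝ | ∃ (s : ℝ≥0) (F G : Ω → ℝ),
    Measurable[pastSigma X s] F ∧ Measurable[futureSigma X (s + r)] G ∧
    (∀ ω, F ω ∈ Set.Icc (0 : ℝ) 1) ∧ (∀ ω, G ω ∈ Set.Icc (0 : ℝ) 1) ∧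
    c = |covariance F G P|}

/-- `M_k(α) < ∞`. -/
def FiniteMixingMoment (k : ℕ) (α : ℝ≥0 → ℝ) : Prop :=
  BddAbove (Set.range fun r : ℝ≥0 => (1 + (r : ℝ)) ^ k * α r)

/-- `M_k(α) = sup_{r ≥ 0} (1 + r)^k α(r)`. -/
noncomputable def mixingMoment (k : ℕ) (α : ℝ≥0 → ℝ) : ℝ :=
  ⨆ r : ℝ≥0, (1 + (r : ℝ)) ^ k * α r

/-!
The bound is Markov's inequality for the `2k`-th moment of `∫₀ᵗ (V(X_s) - μ(V)) ds`. By Jensen's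
inequality, the time integral may be replaced by sums over the grids `u + hℕ` of a fixed mesh `h`.
The power of such a sum expands into joint moments along nondecreasing lists of times. If a list is
cut at its largest gap `r`, its joint moment factorizes up to an error of the order of `α(r h)`; as
all other gaps are smaller, this error is at most a product of weights, one for each gap, which can
be summed one gap after the other. The factors are treated in the same way, by induction on the
length of the list. A mesh of the order `M_k(α)^(1/k)` makes the resulting bound linear in `M_k(α)`.

The upper bounds for the strong mixing coefficient rest on the Markov property, by which
`Cov(F, G) = Cov_μ(f, P_r g)` for some `[0, 1]`-valued `f` and `g`. The Cauchy-Schwarz inequality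
then gives `√η(r)`, and, after splitting `P_r` symmetrically over both factors, `η(r/2)` in the
reversible case.
-/

/-! ### Covariances and strong mixing -/

section covariance

variable {Ω : Type*} [MeasurableSpace Ω] {P : Measure Ω} [IsProbabilityMeasure P] {F G : Ω → ℝ}

lemma abs_covariance_le_sqrt_variance_mul (hF : MemLp F 2 P) (hG : MemLp G 2 P) :
    |cov[F, G; P]| ≤ √Var[F; P] * √Var[G; P] := by
  have hdiscrim : discrim Var[G; P] (2 * cov[F, G; P]) Var[F; P] ≤ 0 := discrim_le_zero fun t => by
    have hadd := variance_add hF (hG.const_mul t)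
    rw [variance_const_mul, covariance_const_mul_right] at hadd
    linarith [variance_nonneg (F + fun ω => t * G ω) P]
  rw [← Real.sqrt_mul (variance_nonneg F P)]
  refine Real.abs_le_sqrt ?_
  rw [discrim] at hdiscrim
  linarith

lemma abs_covariance_le_of_mem_Icc (hF : Measurable F) (hG : Measurable G) {a b c d : ℝ}
    (hFab : ∀ ω, F ω ∈ Set.Icc a b) (hGcd : ∀ ω, G ω ∈ Set.Icc c d) :
    |cov[F, G; P]| ≤ (b - a) / 2 * ((d - c) / 2) := by
  obtain ⟨ω⟩ : Nonempty Ω := nonempty_of_isProbabilityMeasure P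
  have hab : 0 ≤ (b - a) / 2 := by linarith [(hFab ω).1.trans (hFab ω).2]
  refine (abs_covariance_le_sqrt_variance_mul
    (memLp_of_bounded (ae_of_all _ hFab) hF.aestronglyMeasurable 2)
    (memLp_of_bounded (ae_of_all _ hGcd) hG.aestronglyMeasurable 2)).trans ?_
  gcongr
  · exact (Real.sqrt_le_left hab).2 (variance_le_sq_of_bounded (ae_of_all _ hFab) hF.aemeasurable)
  · exact (Real.sqrt_le_left (by linarith [(hGcd ω).1.trans (hGcd ω).2])).2
      (variance_le_sq_of_bounded (ae_of_all _ hGcd) hG.aemeasurable)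

end covariance

section strongMixing

variable {Ω E : Type*} [MeasurableSpace E] {X : ℝ≥0 → Ω → E}

lemma measurable_pastSigma {u s : ℝ≥0} (h : u ≤ s) : Measurable[pastSigma X s] (X u) :=
  Measurable.mono (comap_measurable (X u))
    (le_iSup (fun u : Set.Iic s => MeasurableSpace.comap (X u) inferInstance) ⟨u, h⟩) le_rfl

lemma measurable_futureSigma {u s : ℝ≥0} (h : s ≤ u) : Measurable[futureSigma X s] (X u) :=
  Measurable.mono (comap_measurable (X u))
    (le_iSup (fun u : Set.Ici s => MeasurableSpace.comap (X u) inferInstance) ⟨u, h⟩) le_rfl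

lemma pastSigma_mono {s t : ℝ≥0} (h : s ≤ t) : pastSigma X s ≤ pastSigma X t :=
  iSup_le fun u => (measurable_pastSigma (le_trans u.2 h)).comap_le

variable [mΩ : MeasurableSpace Ω]

lemma pastSigma_le (hX : ∀ t, Measurable (X t)) (s : ℝ≥0) : pastSigma X s ≤ mΩ :=
  iSup_le fun u => (hX u).comap_le

lemma futureSigma_le (hX : ∀ t, Measurable (X t)) (s : ℝ≥0) : futureSigma X s ≤ mΩ :=
  iSup_le fun u => (hX u).comap_le

variable {P : Measure Ω} {s r : ℝ≥0} {F G : Ω → ℝ}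

lemma strongMixing_le {c : ℝ}
    (h : ∀ (s : ℝ≥0) (F G : Ω → ℝ), Measurable[pastSigma X s] F →
      Measurable[futureSigma X (s + r)] G → (∀ ω, F ω ∈ Set.Icc (0 : ℝ) 1) →
      (∀ ω, G ω ∈ Set.Icc (0 : ℝ) 1) → |cov[F, G; P]| ≤ c) :
    strongMixing X P r ≤ c := by
  refine csSup_le ⟨_, 0, 0, 0, measurable_const, measurable_const, by simp, by simp, rfl⟩ ?_
  rintro _ ⟨s, F, G, hF, hG, hF01, hG01, rfl⟩
  exact h s F G hF hG hF01 hG01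

variable [IsProbabilityMeasure P]

lemma abs_covariance_le_strongMixing (hX : ∀ t, Measurable (X t))
    (hF : Measurable[pastSigma X s] F) (hG : Measurable[futureSigma X (s + r)] G)
    (hF01 : ∀ ω, F ω ∈ Set.Icc (0 : ℝ) 1)
    (hG01 : ∀ ω, G ω ∈ Set.Icc (0 : ℝ) 1) :
    |cov[F, G; P]| ≤ strongMixing X P r := by
  refine le_csSup ⟨(1 - 0) / 2 * ((1 - 0) / 2), ?_⟩ ⟨s, F, G, hF, hG, hF01, hG01, rfl⟩
  rintro _ ⟨s, F, G, hF, hG, hF01, hG01, rfl⟩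
  exact abs_covariance_le_of_mem_Icc (hF.mono (pastSigma_le hX s) le_rfl)
    (hG.mono (futureSigma_le hX (s + r)) le_rfl) hF01 hG01

lemma strongMixing_nonneg (hX : ∀ t, Measurable (X t)) (r : ℝ≥0) : 0 ≤ strongMixing X P r :=
  (abs_nonneg _).trans (abs_covariance_le_strongMixing (s := 0) (F := 0) (G := 0) hX
    measurable_const measurable_const (by simp) (by simp))

lemma abs_covariance_le_four_mul_strongMixing (hX : ∀ t, Measurable (X t))
    (hF : Measurable[pastSigma X s] F) (hG : Measurable[futureSigma X (s + r)] G)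
    (hF1 : ∀ ω, |F ω| ≤ 1) (hG1 : ∀ ω, |G ω| ≤ 1) :
    |cov[F, G; P]| ≤ 4 * strongMixing X P r := by
  have integrable {H : Ω → ℝ} (hH : Measurable H) (hH1 : ∀ ω, |H ω| ≤ 1) : Integrable H P :=
    .of_bound hH.aestronglyMeasurable 1 (ae_of_all _ hH1)
  have hF' := integrable (hF.mono (pastSigma_le hX s) le_rfl) hF1
  have hG' := integrable (hG.mono (futureSigma_le hX _) le_rfl) hG1
  have hscale : cov[fun ω => (1 + F ω) / 2, fun ω => (1 + G ω) / 2; P] = cov[F, G; P] / 4 := by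
    rw [covariance_fun_div_left, covariance_fun_div_right, covariance_const_add_left hF',
      covariance_const_add_right hG']
    ring
  have hmix := abs_covariance_le_strongMixing (P := P) hX ((hF.const_add 1).div_const 2)
    ((hG.const_add 1).div_const 2)
    (fun ω => ⟨by linarith [neg_le_of_abs_le (hF1 ω)], by linarith [le_of_abs_le (hF1 ω)]⟩)
    (fun ω => ⟨by linarith [neg_le_of_abs_le (hG1 ω)], by linarith [le_of_abs_le (hG1 ω)]⟩)
  rw [hscale, abs_div, abs_of_pos (zero_lt_four' ℝ)] at hmix
  linarith

end strongMixing

/-! ### Decay of the semigroup and strong mixing -/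

section conditioning

variable {Ω E : Type*} {m : MeasurableSpace Ω} [mΩ : MeasurableSpace Ω] [MeasurableSpace E]
  {P : Measure Ω} {F F' G : Ω → ℝ}

lemma setIntegral_eq_of_isPiSystem (hm : m ≤ mΩ) {C : Set (Set Ω)}
    (hmC : m = MeasurableSpace.generateFrom C) (hC : IsPiSystem C) (hF : Integrable F P)
    (hF' : Integrable F' P) (huniv : ∫ ω, F ω ∂P = ∫ ω, F' ω ∂P)
    (h : ∀ A ∈ C, ∫ ω in A, F ω ∂P = ∫ ω in A, F' ω ∂P) {A : Set Ω} (hA : MeasurableSet[m] A) :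
    ∫ ω in A, F ω ∂P = ∫ ω in A, F' ω ∂P := by
  induction A, hA using MeasurableSpace.induction_on_inter hmC hC with
  | empty => simp
  | basic A hA => exact h A hA
  | compl A hA ih => rw [setIntegral_compl (hm A hA) hF, setIntegral_compl (hm A hA) hF', huniv, ih]
  | iUnion A hdisj hA ih =>
    rw [integral_iUnion (fun i => hm _ (hA i)) hdisj hF.integrableOn,
      integral_iUnion (fun i => hm _ (hA i)) hdisj hF'.integrableOn]
    exact tsum_congr ih

variable [IsFiniteMeasure P]

lemma integral_mul_eq_of_setIntegral_eq (hm : m ≤ mΩ) (hF : Integrable F P) (hF' : Integrable F' P)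
    (h : ∀ A, MeasurableSet[m] A → ∫ ω in A, F ω ∂P = ∫ ω in A, F' ω ∂P)
    (hG : Measurable[m] G) {c : ℝ} (hGc : ∀ ω, |G ω| ≤ c) :
    ∫ ω, G ω * F ω ∂P = ∫ ω, G ω * F' ω ∂P := by
  have hcond : P[F | m] =ᵐ[P] P[F' | m] :=
    ae_eq_condExp_of_forall_setIntegral_eq hm hF' (fun _ _ _ => integrable_condExp.integrableOn)
      (fun A hA _ => (setIntegral_condExp hm hF hA).trans (h A hA))
      stronglyMeasurable_condExp.aestronglyMeasurable
  have hpull {H : Ω → ℝ} (hH : Integrable H P) :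
      ∫ ω, G ω * H ω ∂P = ∫ ω, G ω * P[H | m] ω ∂P := by
    rw [← integral_condExp hm]
    exact integral_congr_ae (condExp_stronglyMeasurable_mul_of_bound hm hG.stronglyMeasurable hH c
      (ae_of_all _ hGc))
  rw [hpull hF, hpull hF']
  exact integral_congr_ae (hcond.mono fun ω hω => by simp only [hω])

variable [Nonempty Ω] {X : Ω → E} {a b : ℝ}

lemma exists_comp_ae_eq_condExp_comap (hX : Measurable X) (hF : Measurable F)
    (hFab : ∀ ω, F ω ∈ Set.Icc a b) :
    ∃ w : E → ℝ, Measurable w ∧ (∀ x, w x ∈ Set.Icc a b) ∧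
      (fun ω => w (X ω)) =ᵐ[P] P[F | MeasurableSpace.comap X inferInstance] := by
  have hab : a ≤ b := (hFab (Classical.arbitrary Ω)).1.trans (hFab _).2
  have hint : Integrable F P := .of_mem_Icc a b hF.aemeasurable (ae_of_all _ hFab)
  have hlower : (fun _ => a) ≤ᵐ[P] P[F | MeasurableSpace.comap X inferInstance] := by
    rw [← condExp_const (μ := P) hX.comap_le a]
    exact condExp_mono (integrable_const a) hint (ae_of_all P fun ω => (hFab ω).1)
  have hupper : P[F | MeasurableSpace.comap X inferInstance] ≤ᵐ[P] fun _ => b := by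
    rw [← condExp_const (μ := P) hX.comap_le b]
    exact condExp_mono hint (integrable_const b) (ae_of_all P fun ω => (hFab ω).2)
  obtain ⟨w, hw, hwX⟩ : ∃ w : E → ℝ, Measurable w ∧
      P[F | MeasurableSpace.comap X inferInstance] = w ∘ X :=
    stronglyMeasurable_condExp.measurable.exists_eq_measurable_comp
  refine ⟨fun x => max a (min b (w x)), measurable_const.max (measurable_const.min hw),
    fun x => ⟨le_max_left _ _, max_le hab (min_le_left _ _)⟩, ?_⟩
  filter_upwards [hlower, hupper] with ω hlω huω
  rw [hwX] at hlω huω ⊢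
  exact (congrArg (max a) (min_eq_right huω)).trans (max_eq_right hlω)

lemma exists_integral_mul_comp_eq (hX : Measurable X) (hF : Measurable F)
    (hFab : ∀ ω, F ω ∈ Set.Icc a b) :
    ∃ w : E → ℝ, Measurable w ∧ (∀ x, w x ∈ Set.Icc a b) ∧ ∀ h : E → ℝ, Measurable h →
      ∀ c, (∀ x, |h x| ≤ c) → ∫ ω, F ω * h (X ω) ∂P = ∫ ω, w (X ω) * h (X ω) ∂P := by
  obtain ⟨w, hw, hwab, hwX⟩ := exists_comp_ae_eq_condExp_comap (P := P) hX hF hFab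
  have hint : Integrable F P := .of_mem_Icc a b hF.aemeasurable (ae_of_all _ hFab)
  refine ⟨w, hw, hwab, fun h hh c hc => ?_⟩
  simp only [mul_comm _ (h _)]
  refine integral_mul_eq_of_setIntegral_eq hX.comap_le hint (integrable_condExp.congr hwX.symm)
    (fun A hA => ?_) (hh.comp (comap_measurable X)) fun ω => hc _
  rw [← setIntegral_condExp hX.comap_le hint hA]
  exact integral_congr_ae (ae_restrict_of_ae hwX.symm)

end conditioning

section kernel

variable {α β : Type*} [MeasurableSpace α] [MeasurableSpace β] {μ : Measure α}

lemma integral_bind_kernel {κ : Kernel α β} {f : β → ℝ} (hf : Integrable f (μ.bind κ)) :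
    ∫ y, f y ∂(μ.bind κ) = ∫ x, ∫ y, f y ∂(κ x) ∂μ := by
  rw [Measure.comp_eq_comp_const_apply] at hf ⊢
  rw [Kernel.integral_comp hf]
  simp

lemma integral_mul_integral_comm_of_isReversible [IsFiniteMeasure μ] {κ : Kernel α α}
    [IsFiniteKernel κ] (hκ : κ.IsReversible μ) {f g : α → ℝ} (hf : Measurable f) {c : ℝ}
    (hfc : ∀ x, |f x| ≤ c) (hg : Measurable g) {d : ℝ} (hgd : ∀ x, |g x| ≤ d) :
    ∫ x, f x * ∫ y, g y ∂(κ x) ∂μ = ∫ x, (∫ y, f y ∂(κ x)) * g x ∂μ := by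
  have hswap : (μ ⊗ₘ κ).map Prod.swap = μ ⊗ₘ κ := by
    refine Measure.ext_prod fun {A} {B} hA hB => ?_
    rw [Measure.map_apply measurable_swap (hA.prod hB), Set.preimage_swap_prod,
      Measure.compProd_apply_prod hA hB, Measure.compProd_apply_prod hB hA, hκ hB hA]
  have hint : Integrable (fun p : α × α => f p.1 * g p.2) (μ ⊗ₘ κ) :=
    .of_bound (by fun_prop) (c * d) (ae_of_all _ fun p => by
      rw [norm_mul]
      exact mul_le_mul (hfc _) (hgd _) (norm_nonneg _) ((abs_nonneg _).trans (hfc p.1)))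
  have hint' : Integrable (fun p : α × α => f p.2 * g p.1) (μ ⊗ₘ κ) := by
    rw [← hswap] at hint
    exact hint.comp_measurable measurable_swap
  calc ∫ x, f x * ∫ y, g y ∂(κ x) ∂μ
      = ∫ p, f p.1 * g p.2 ∂(μ ⊗ₘ κ) := by
        simp only [Measure.integral_compProd hint, integral_const_mul]
    _ = ∫ p, f p.2 * g p.1 ∂(μ ⊗ₘ κ) := by
        conv_lhs => rw [← hswap, integral_map measurable_swap.aemeasurable (by fun_prop)]
        rfl
    _ = ∫ x, (∫ y, f y ∂(κ x)) * g x ∂μ := by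
        simp only [Measure.integral_compProd hint', integral_mul_const]

end kernel

namespace MarkovProcess

variable {Ω E : Type*} [MeasurableSpace Ω] [MeasurableSpace E]

section law

variable (Y : MarkovProcess Ω E)

instance : IsMarkovKernel Y.law := Y.isMarkovKernel_law

lemma measurable_X (t : ℝ≥0) : Measurable (Y.X t) :=
  Y.measurable_uncurry.of_uncurry_left

instance (t : ℝ≥0) : IsMarkovKernel (Y.transition t) :=
  Kernel.IsMarkovKernel.map _ (Y.measurable_X t)

instance (μ : Measure E) [IsProbabilityMeasure μ] : IsProbabilityMeasure (Y.lawFrom μ) := by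
  unfold lawFrom
  infer_instance

lemma transition_add (s t : ℝ≥0) : Y.transition (s + t) = Y.transition t ∘ₖ Y.transition s := by
  ext x B hB
  have h := Y.markov x s t Set.univ B MeasurableSet.univ hB
  rw [Kernel.comp_apply' _ _ _ hB]
  unfold transition
  rw [Kernel.map_apply' _ (Y.measurable_X _) _ hB, Kernel.map_apply _ (Y.measurable_X s),
    lintegral_map (Kernel.measurable_coe _ hB) (Y.measurable_X s)]
  simpa [Kernel.map_apply _ (Y.measurable_X t)] using h

end law

variable {Y : MarkovProcess Ω E} {μ : Measure E}

lemma map_X_lawFrom (hμ : Y.IsInvariant μ) (t : ℝ≥0) : (Y.lawFrom μ).map (Y.X t) = μ :=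
  (Measure.map_comp μ Y.law (Y.measurable_X t)).trans (hμ t)

section semigroup

variable {f : E → ℝ} {c : ℝ}

lemma measurable_semigroup (t : ℝ≥0) (hf : Measurable f) : Measurable (Y.semigroup t f) :=
  hf.stronglyMeasurable.integral_kernel.measurable

lemma abs_semigroup_le (t : ℝ≥0) (hc : ∀ x, |f x| ≤ c) (x : E) : |Y.semigroup t f x| ≤ c := by
  simpa [semigroup] using
    norm_integral_le_of_norm_le_const (μ := Y.transition t x) (f := f) (ae_of_all _ hc)

lemma semigroup_add (s t : ℝ≥0) (hf : Measurable f) (hc : ∀ x, |f x| ≤ c) :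
    Y.semigroup (s + t) f = Y.semigroup s (Y.semigroup t f) := by
  funext x
  unfold semigroup
  rw [transition_add, Kernel.integral_comp (.of_bound hf.aestronglyMeasurable c (ae_of_all _ hc))]

variable [IsProbabilityMeasure μ]

lemma integral_semigroup (hμ : Y.IsInvariant μ) (t : ℝ≥0) (hf : Measurable f)
    (hc : ∀ x, |f x| ≤ c) : ∫ x, Y.semigroup t f x ∂μ = ∫ x, f x ∂μ := by
  conv_rhs => rw [← (hμ t).def]
  exact (integral_bind_kernel (.of_bound hf.aestronglyMeasurable c (ae_of_all _ hc))).symm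

end semigroup

section markov

lemma map_X_add_restrict_lawFrom (s t : ℝ≥0) {A : Set Ω} (hA : MeasurableSet[pastSigma Y.X s] A) :
    ((Y.lawFrom μ).restrict A).map (Y.X (s + t)) =
      (((Y.lawFrom μ).restrict A).map (Y.X s)).bind (Y.transition t) := by
  have hA' : MeasurableSet A := pastSigma_le Y.measurable_X s _ hA
  ext B hB
  have hm : Measurable fun ω => Y.transition t (Y.X s ω) B :=
    (Kernel.measurable_coe _ hB).comp (Y.measurable_X s)
  rw [Measure.map_apply (Y.measurable_X _) hB, Measure.restrict_apply (Y.measurable_X _ hB),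
    Measure.bind_apply hB (Kernel.aemeasurable _),
    lintegral_map (Kernel.measurable_coe _ hB) (Y.measurable_X s), ← lintegral_indicator hA']
  unfold lawFrom
  rw [Measure.bind_apply ((Y.measurable_X _ hB).inter hA') (Kernel.aemeasurable _),
    Measure.lintegral_bind (Kernel.aemeasurable _) (hm.indicator hA').aemeasurable]
  refine lintegral_congr fun x => ?_
  rw [Set.inter_comm, Y.markov x s t A B hA hB, lintegral_indicator hA']
  simp [transition, Kernel.map_apply _ (Y.measurable_X t)]

variable [IsProbabilityMeasure μ]

lemma integral_mul_comp_X_add (s t : ℝ≥0) {F : Ω → ℝ} (hF : Measurable[pastSigma Y.X s] F) {b : ℝ}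
    (hb : ∀ ω, |F ω| ≤ b) {f : E → ℝ} (hf : Measurable f) {c : ℝ} (hc : ∀ x, |f x| ≤ c) :
    ∫ ω, F ω * f (Y.X (s + t) ω) ∂(Y.lawFrom μ) =
      ∫ ω, F ω * Y.semigroup t f (Y.X s ω) ∂(Y.lawFrom μ) := by
  have hPf := measurable_semigroup (Y := Y) t hf
  refine integral_mul_eq_of_setIntegral_eq (pastSigma_le Y.measurable_X s)
    (.of_bound (hf.comp (Y.measurable_X _)).aestronglyMeasurable c (ae_of_all _ fun ω => hc _))
    (.of_bound (hPf.comp (Y.measurable_X s)).aestronglyMeasurable c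
      (ae_of_all _ fun ω => abs_semigroup_le t hc _)) (fun A hA => ?_) hF hb
  rw [← integral_map (f := f) (Y.measurable_X _).aemeasurable hf.aestronglyMeasurable,
    map_X_add_restrict_lawFrom s t hA,
    integral_bind_kernel (.of_bound hf.aestronglyMeasurable c (ae_of_all _ hc))]
  exact integral_map (Y.measurable_X s).aemeasurable hPf.aestronglyMeasurable

lemma exists_setIntegral_cylinder_eq (T : Finset ℝ≥0) {u : ℝ≥0} (hT : ∀ t ∈ T, u ≤ t)
    {A : ℝ≥0 → Set Ω}
    (hA : ∀ t ∈ T, MeasurableSet[MeasurableSpace.comap (Y.X t) inferInstance] (A t)) :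
    ∃ g : E → ℝ, Measurable g ∧ (∀ x, |g x| ≤ 1) ∧ ∀ F : Ω → ℝ, Measurable[pastSigma Y.X u] F →
      ∀ b, (∀ ω, |F ω| ≤ b) →
        ∫ ω in ⋂ t ∈ T, A t, F ω ∂(Y.lawFrom μ) = ∫ ω, F ω * g (Y.X u ω) ∂(Y.lawFrom μ) := by
  induction T using Finset.induction_on_min generalizing u with
  | empty => exact ⟨1, measurable_const, by simp, by simp⟩
  | insert a T haT ih =>
    obtain ⟨B, hB, hBA⟩ := hA a (Finset.mem_insert_self a T)
    obtain ⟨g, hg, hg1, hTg⟩ := ih (u := a) (fun t ht => (haT t ht).le)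
      fun t ht => hA t (Finset.mem_insert_of_mem ht)
    have hBg1 : ∀ x, |B.indicator g x| ≤ 1 := fun x =>
      (norm_indicator_le_norm_self g x).trans (hg1 x)
    obtain ⟨d, rfl⟩ := exists_add_of_le (hT a (Finset.mem_insert_self a T))
    refine ⟨Y.semigroup d (B.indicator g), measurable_semigroup d (hg.indicator hB),
      abs_semigroup_le d hBg1, fun F hF b hb => ?_⟩
    have hXB : MeasurableSet[pastSigma Y.X (u + d)] (Y.X (u + d) ⁻¹' B) :=
      measurable_pastSigma le_rfl hB
    calc ∫ ω in ⋂ t ∈ insert (u + d) T, A t, F ω ∂(Y.lawFrom μ)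
        = ∫ ω in ⋂ t ∈ T, A t, (Y.X (u + d) ⁻¹' B).indicator F ω ∂(Y.lawFrom μ) := by
          rw [setIntegral_indicator (Y.measurable_X _ hB), Finset.set_biInter_insert, ← hBA,
            Set.inter_comm]
      _ = ∫ ω, (Y.X (u + d) ⁻¹' B).indicator F ω * g (Y.X (u + d) ω) ∂(Y.lawFrom μ) :=
          hTg _ ((hF.mono (pastSigma_mono le_self_add) le_rfl).indicator hXB) b fun ω =>
            (norm_indicator_le_norm_self F ω).trans (hb ω)
      _ = ∫ ω, F ω * B.indicator g (Y.X (u + d) ω) ∂(Y.lawFrom μ) := by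
          refine integral_congr_ae (ae_of_all _ fun ω => ?_)
          by_cases h : Y.X (u + d) ω ∈ B <;> simp [h]
      _ = ∫ ω, F ω * Y.semigroup d (B.indicator g) (Y.X u ω) ∂(Y.lawFrom μ) :=
          integral_mul_comp_X_add u d hF hb (hg.indicator hB) hBg1

lemma setIntegral_futureSigma_eq {u : ℝ≥0} {F : Ω → ℝ} (hF : Measurable[pastSigma Y.X u] F) {b : ℝ}
    (hb : ∀ ω, |F ω| ≤ b) {w : E → ℝ} (hw : Measurable w) (hwb : ∀ x, |w x| ≤ b)
    (hFw : ∀ h : E → ℝ, Measurable h → ∀ c, (∀ x, |h x| ≤ c) →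
      ∫ ω, F ω * h (Y.X u ω) ∂(Y.lawFrom μ) = ∫ ω, w (Y.X u ω) * h (Y.X u ω) ∂(Y.lawFrom μ))
    {A : Set Ω} (hA : MeasurableSet[futureSigma Y.X u] A) :
    ∫ ω in A, F ω ∂(Y.lawFrom μ) = ∫ ω in A, w (Y.X u ω) ∂(Y.lawFrom μ) := by
  have hgen := generateFrom_piiUnionInter_measurableSet
    (fun t => MeasurableSpace.comap (Y.X t) inferInstance) (Set.Ici u)
  rw [iSup_subtype'] at hgen
  refine setIntegral_eq_of_isPiSystem (futureSigma_le Y.measurable_X u) hgen.symm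
    (isPiSystem_piiUnionInter _ (fun t => @MeasurableSpace.isPiSystem_measurableSet _ (_)) _)
    (.of_bound (hF.mono (pastSigma_le Y.measurable_X u) le_rfl).aestronglyMeasurable b
      (ae_of_all _ hb))
    (.of_bound (hw.comp (Y.measurable_X u)).aestronglyMeasurable b (ae_of_all _ fun ω => hwb _))
    (by simpa using hFw 1 measurable_const 1 (by simp)) ?_ hA
  rintro _ ⟨T, hT, A, hA, rfl⟩
  obtain ⟨g, hg, hg1, hTg⟩ := exists_setIntegral_cylinder_eq (Y := Y) (μ := μ) T hT hA
  exact (hTg F hF b hb).trans ((hFw g hg 1 hg1).trans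
    (hTg _ (hw.comp (measurable_pastSigma le_rfl)) b fun ω => hwb _).symm)

lemma exists_integral_past_mul_future_eq {u : ℝ≥0} {G : Ω → ℝ}
    (hG : Measurable[futureSigma Y.X u] G) (hG01 : ∀ ω, G ω ∈ Set.Icc (0 : ℝ) 1) :
    ∃ g : E → ℝ, Measurable g ∧ (∀ x, g x ∈ Set.Icc (0 : ℝ) 1) ∧ ∀ F : Ω → ℝ,
      Measurable[pastSigma Y.X u] F → (∀ ω, F ω ∈ Set.Icc (0 : ℝ) 1) →
        ∫ ω, F ω * G ω ∂(Y.lawFrom μ) = ∫ ω, F ω * g (Y.X u ω) ∂(Y.lawFrom μ) := by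
  have abs_le {x : ℝ} (hx : x ∈ Set.Icc (0 : ℝ) 1) : |x| ≤ 1 :=
    (abs_of_nonneg hx.1).trans_le hx.2
  have : Nonempty Ω := nonempty_of_isProbabilityMeasure (Y.lawFrom μ)
  obtain ⟨g, hg, hg01, hGg⟩ := exists_integral_mul_comp_eq (P := Y.lawFrom μ) (Y.measurable_X u)
    (hG.mono (futureSigma_le Y.measurable_X u) le_rfl) hG01
  refine ⟨g, hg, hg01, fun F hF hF01 => ?_⟩
  have hF' := hF.mono (pastSigma_le Y.measurable_X u) le_rfl
  obtain ⟨w, hw, hw01, hFw⟩ := exists_integral_mul_comp_eq (P := Y.lawFrom μ) (Y.measurable_X u)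
    hF' hF01
  calc ∫ ω, F ω * G ω ∂(Y.lawFrom μ)
      = ∫ ω, G ω * F ω ∂(Y.lawFrom μ) := by simp only [mul_comm]
    _ = ∫ ω, G ω * w (Y.X u ω) ∂(Y.lawFrom μ) :=
      integral_mul_eq_of_setIntegral_eq (futureSigma_le Y.measurable_X u)
        (.of_mem_Icc 0 1 hF'.aemeasurable (ae_of_all _ hF01))
        (.of_mem_Icc 0 1 (hw.comp (Y.measurable_X u)).aemeasurable (ae_of_all _ fun ω => hw01 _))
        (fun A hA => setIntegral_futureSigma_eq hF (fun ω => abs_le (hF01 ω)) hw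
          (fun x => abs_le (hw01 x)) hFw hA) hG fun ω => abs_le (hG01 ω)
    _ = ∫ ω, g (Y.X u ω) * w (Y.X u ω) ∂(Y.lawFrom μ) := hGg w hw 1 fun x => abs_le (hw01 x)
    _ = ∫ ω, w (Y.X u ω) * g (Y.X u ω) ∂(Y.lawFrom μ) := by simp only [mul_comm]
    _ = ∫ ω, F ω * g (Y.X u ω) ∂(Y.lawFrom μ) := (hFw g hg 1 fun x => abs_le (hg01 x)).symm

end markov

section mixing

variable [IsProbabilityMeasure μ]

lemma exists_covariance_eq_covariance_semigroup (hμ : Y.IsInvariant μ) {s r : ℝ≥0} {F G : Ω → ℝ}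
    (hF : Measurable[pastSigma Y.X s] F) (hG : Measurable[futureSigma Y.X (s + r)] G)
    (hF01 : ∀ ω, F ω ∈ Set.Icc (0 : ℝ) 1) (hG01 : ∀ ω, G ω ∈ Set.Icc (0 : ℝ) 1) :
    ∃ f g : E → ℝ, Measurable f ∧ (∀ x, f x ∈ Set.Icc (0 : ℝ) 1) ∧ Measurable g ∧
      (∀ x, g x ∈ Set.Icc (0 : ℝ) 1) ∧ cov[F, G; Y.lawFrom μ] = cov[f, Y.semigroup r g; μ] := by
  have abs_le {x : ℝ} (hx : x ∈ Set.Icc (0 : ℝ) 1) : |x| ≤ 1 :=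
    (abs_of_nonneg hx.1).trans_le hx.2
  have : Nonempty Ω := nonempty_of_isProbabilityMeasure (Y.lawFrom μ)
  have hF' := hF.mono (pastSigma_le Y.measurable_X s) le_rfl
  have hG' := hG.mono (futureSigma_le Y.measurable_X (s + r)) le_rfl
  obtain ⟨f, hf, hf01, hFf⟩ := exists_integral_mul_comp_eq (P := Y.lawFrom μ) (Y.measurable_X s)
    hF' hF01
  obtain ⟨g, hg, hg01, hGg⟩ := exists_integral_past_mul_future_eq (μ := μ) hG hG01
  have hg1 : ∀ x, |g x| ≤ 1 := fun x => abs_le (hg01 x)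
  have hPg := measurable_semigroup (Y := Y) r hg
  have stationary (t : ℝ≥0) {h : E → ℝ} (hh : Measurable h) :
      ∫ ω, h (Y.X t ω) ∂(Y.lawFrom μ) = ∫ x, h x ∂μ := by
    conv_rhs => rw [← map_X_lawFrom hμ t]
    exact (integral_map (Y.measurable_X t).aemeasurable hh.aestronglyMeasurable).symm
  have hmeanF : ∫ ω, F ω ∂(Y.lawFrom μ) = ∫ x, f x ∂μ := by
    simpa [stationary s hf] using hFf 1 measurable_const 1 (by simp)
  have hmeanG : ∫ ω, G ω ∂(Y.lawFrom μ) = ∫ x, Y.semigroup r g x ∂μ := by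
    simpa [stationary (s + r) hg, integral_semigroup hμ r hg hg1] using
      hGg 1 measurable_const (by simp)
  have hmeanFG : ∫ ω, F ω * G ω ∂(Y.lawFrom μ) = ∫ x, f x * Y.semigroup r g x ∂μ := by
    rw [hGg F (hF.mono (pastSigma_mono le_self_add) le_rfl) hF01,
      integral_mul_comp_X_add s r hF (fun ω => abs_le (hF01 ω)) hg hg1,
      hFf _ hPg 1 (abs_semigroup_le r hg1)]
    exact stationary s (hf.mul hPg)
  refine ⟨f, g, hf, hf01, hg, hg01, ?_⟩
  rw [covariance_eq_sub (memLp_of_bounded (ae_of_all _ hF01) hF'.aestronglyMeasurable 2)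
      (memLp_of_bounded (ae_of_all _ hG01) hG'.aestronglyMeasurable 2),
    covariance_eq_sub (memLp_of_bounded (ae_of_all _ hf01) hf.aestronglyMeasurable 2)
      (.of_bound hPg.aestronglyMeasurable 1 (ae_of_all _ (abs_semigroup_le r hg1)))]
  simp only [Pi.mul_apply, hmeanF, hmeanG, hmeanFG]

lemma Decay.variance_semigroup_le {η : ℝ≥0 → ℝ≥0} (hη : Y.Decay μ η) (t : ℝ≥0) {f : E → ℝ}
    (hf : Measurable f) (hf01 : ∀ x, f x ∈ Set.Icc (0 : ℝ) 1) :
    Var[Y.semigroup t f; μ] ≤ η t := by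
  have hmean0 : 0 ≤ ∫ x, f x ∂μ := integral_nonneg fun x => (hf01 x).1
  have hmean1 : ∫ x, f x ∂μ ≤ 1 := by
    simpa using integral_mono (μ := μ) (.of_mem_Icc 0 1 hf.aemeasurable (ae_of_all _ hf01))
      (integrable_const (1 : ℝ)) fun x => (hf01 x).2
  have hosc : ⨆ x, |f x - ∫ y, f y ∂μ| ≤ 1 :=
    Real.iSup_le (fun x => abs_le.2 ⟨by linarith [(hf01 x).1], by linarith [(hf01 x).2]⟩)
      zero_le_one
  refine (hη.2 f hf ⟨1, fun x => abs_le.2 ⟨by linarith [(hf01 x).1], (hf01 x).2⟩⟩ t).trans ?_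
  exact mul_le_of_le_one_right (η t).coe_nonneg
    (pow_le_one₀ (Real.iSup_nonneg fun _ => abs_nonneg _) hosc)

lemma covariance_semigroup_add_eq (hμ : Y.IsSymmetric μ) (s t : ℝ≥0) {f g : E → ℝ}
    (hf : Measurable f) {c : ℝ} (hfc : ∀ x, |f x| ≤ c) (hg : Measurable g) {d : ℝ}
    (hgd : ∀ x, |g x| ≤ d) :
    cov[f, Y.semigroup (s + t) g; μ] = cov[Y.semigroup s f, Y.semigroup t g; μ] := by
  have hinv : Y.IsInvariant μ := fun t => (hμ t).invariant
  have hLp {h : E → ℝ} (hh : Measurable h) {b : ℝ} (hb : ∀ x, |h x| ≤ b) : MemLp h 2 μ :=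
    .of_bound hh.aestronglyMeasurable b (ae_of_all _ hb)
  have hPg := measurable_semigroup (Y := Y) t hg
  have hPgd := abs_semigroup_le (Y := Y) t hgd
  rw [covariance_eq_sub (hLp hf hfc)
      (hLp (measurable_semigroup _ hg) (abs_semigroup_le _ hgd)),
    covariance_eq_sub (hLp (measurable_semigroup s hf) (abs_semigroup_le s hfc)) (hLp hPg hPgd),
    integral_semigroup hinv _ hg hgd, integral_semigroup hinv s hf hfc,
    integral_semigroup hinv t hg hgd, semigroup_add s t hg hgd]
  congr 1
  exact integral_mul_integral_comm_of_isReversible (hμ s) hf hfc hPg hPgd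

theorem strongMixing_le_sqrt (hμ : Y.IsInvariant μ) {η : ℝ≥0 → ℝ≥0} (hη : Y.Decay μ η) (r : ℝ≥0) :
    strongMixing Y.X (Y.lawFrom μ) r ≤ √(η r) := by
  refine strongMixing_le fun s F G hF hG hF01 hG01 => ?_
  obtain ⟨f, g, hf, hf01, hg, hg01, hcov⟩ :=
    exists_covariance_eq_covariance_semigroup hμ hF hG hF01 hG01
  have hg1 : ∀ x, |g x| ≤ 1 := fun x => (abs_of_nonneg (hg01 x).1).trans_le (hg01 x).2
  have hvarf : √Var[f; μ] ≤ 1 := by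
    have := variance_le_sq_of_bounded (ae_of_all _ hf01) hf.aemeasurable (μ := μ)
    exact Real.sqrt_le_one.2 (this.trans (by norm_num))
  calc |cov[F, G; Y.lawFrom μ]| = |cov[f, Y.semigroup r g; μ]| := by rw [hcov]
    _ ≤ √Var[f; μ] * √Var[Y.semigroup r g; μ] :=
      abs_covariance_le_sqrt_variance_mul
        (memLp_of_bounded (ae_of_all _ hf01) hf.aestronglyMeasurable 2)
        (.of_bound (measurable_semigroup r hg).aestronglyMeasurable 1
          (ae_of_all _ (abs_semigroup_le r hg1)))
    _ ≤ 1 * √(η r) := by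
      gcongr
      exact hη.variance_semigroup_le r hg hg01
    _ = √(η r) := one_mul _

theorem strongMixing_le_of_isSymmetric (hμ : Y.IsSymmetric μ) {η : ℝ≥0 → ℝ≥0} (hη : Y.Decay μ η)
    (r : ℝ≥0) : strongMixing Y.X (Y.lawFrom μ) r ≤ η (r / 2) := by
  refine strongMixing_le fun s F G hF hG hF01 hG01 => ?_
  obtain ⟨f, g, hf, hf01, hg, hg01, hcov⟩ :=
    exists_covariance_eq_covariance_semigroup (fun t => (hμ t).invariant) hF hG hF01 hG01
  have abs_le {h : E → ℝ} (hh : ∀ x, h x ∈ Set.Icc (0 : ℝ) 1) (x : E) : |h x| ≤ 1 :=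
    (abs_of_nonneg (hh x).1).trans_le (hh x).2
  have hLp {h : E → ℝ} (hh : Measurable h) (hh01 : ∀ x, h x ∈ Set.Icc (0 : ℝ) 1) :
      MemLp (Y.semigroup (r / 2) h) 2 μ :=
    .of_bound (measurable_semigroup _ hh).aestronglyMeasurable 1
      (ae_of_all _ (abs_semigroup_le _ (abs_le hh01)))
  calc |cov[F, G; Y.lawFrom μ]|
      = |cov[Y.semigroup (r / 2) f, Y.semigroup (r / 2) g; μ]| := by
        rw [hcov, ← covariance_semigroup_add_eq hμ _ _ hf (abs_le hf01) hg (abs_le hg01),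
          add_halves]
    _ ≤ √Var[Y.semigroup (r / 2) f; μ] * √Var[Y.semigroup (r / 2) g; μ] :=
      abs_covariance_le_sqrt_variance_mul (hLp hf hf01) (hLp hg hg01)
    _ ≤ √(η (r / 2)) * √(η (r / 2)) := by
      gcongr <;> apply hη.variance_semigroup_le <;> assumption
    _ = η (r / 2) := Real.mul_self_sqrt (η (r / 2)).coe_nonneg

theorem strongMixing_le_of_decay (hμ : Y.IsInvariant μ) {η : ℝ≥0 → ℝ≥0} (hη : Y.Decay μ η)
    {α : ℝ≥0 → ℝ}
    (hα : α = strongMixing Y.X (Y.lawFrom μ) ∨ α = (fun r => √(η r)) ∨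
      (Y.IsSymmetric μ ∧ α = fun r => (η (r / 2) : ℝ))) (r : ℝ≥0) :
    strongMixing Y.X (Y.lawFrom μ) r ≤ α r := by
  rcases hα with rfl | rfl | ⟨hsymm, rfl⟩
  exacts [le_rfl, strongMixing_le_sqrt hμ hη r, strongMixing_le_of_isSymmetric hsymm hη r]

end mixing

end MarkovProcess

/-! ### Sums over sorted lists of times -/

/-- The nondecreasing lists of length `n` with entries in `[a, N)`. -/
def sortedLists (N : ℕ) : ℕ → ℕ → Finset (List ℕ)
  | _, 0 => {[]}
  | a, n + 1 => (Finset.Ico a N).biUnion fun b => (sortedLists N b n).image (List.cons b)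

lemma mem_sortedLists {N : ℕ} {n a : ℕ} {l : List ℕ} :
    l ∈ sortedLists N a n ↔
      l.length = n ∧ (a :: l).Pairwise (· ≤ ·) ∧ ∀ i ∈ l, i < N := by
  induction n generalizing a l with
  | zero => cases l <;> simp [sortedLists]
  | succ n ih =>
    rcases l with _ | ⟨b, l⟩
    · simp [sortedLists]
    · simp only [sortedLists, Finset.mem_biUnion, Finset.mem_Ico, Finset.mem_image,
        List.cons.injEq, List.length_cons, List.pairwise_cons, List.forall_mem_cons, ih]
      constructor
      · rintro ⟨b, ⟨hab, hbN⟩, l, ⟨hl, ⟨hb, hs⟩, hN⟩, rfl, rfl⟩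
        exact ⟨by omega, ⟨⟨hab, fun i hi => hab.trans (hb i hi)⟩, hb, hs⟩, hbN, hN⟩
      · rintro ⟨hl, ⟨⟨hab, -⟩, hb, hs⟩, hbN, hN⟩
        exact ⟨b, ⟨hab, hbN⟩, l, ⟨by omega, ⟨hb, hs⟩, hN⟩, rfl, rfl⟩

lemma sum_sortedLists_succ {M : Type*} [AddCommMonoid M] (N a n : ℕ) (f : List ℕ → M) :
    ∑ l ∈ sortedLists N a (n + 1), f l =
      ∑ b ∈ Finset.Ico a N, ∑ l ∈ sortedLists N b n, f (b :: l) := by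
  rw [sortedLists, Finset.sum_biUnion]
  · exact Finset.sum_congr rfl fun b _ => Finset.sum_image (List.cons_injective.injOn)
  · intro b _ c _ hbc
    simp only [Function.onFun, Finset.disjoint_left, Finset.mem_image]
    grind

lemma sum_sym_range {M : Type*} [AddCommMonoid M] (N n : ℕ) (f : Multiset ℕ → M) :
    ∑ m ∈ (Finset.range N).sym n, f m = ∑ l ∈ sortedLists N 0 n, f l := by
  refine Finset.sum_bij' (fun m _ => (m : Multiset ℕ).sort (· ≤ ·))
    (fun l hl => ⟨l, by simpa using (mem_sortedLists.1 hl).1⟩) ?_ ?_ ?_ ?_ ?_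
  · intro m hm
    simp only [Finset.mem_sym_iff, Finset.mem_range] at hm
    exact mem_sortedLists.2 ⟨by simp, by simp, fun i hi => hm i (by simpa using hi)⟩
  · intro l hl
    refine Finset.mem_sym_iff.2 fun i hi => Finset.mem_range.2 ?_
    exact (mem_sortedLists.1 hl).2.2 i (by simpa using hi)
  · intro m _
    ext1
    simp
  · intro l hl
    have h := (mem_sortedLists.1 hl).2.1
    simpa using List.mergeSort_eq_self _ (List.pairwise_cons.1 h).2
  · intro m _
    simp

lemma countPerms_le_factorial {α : Type*} [DecidableEq α] (m : Multiset α) :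
    m.countPerms ≤ m.card.factorial := by
  rw [Multiset.countPerms, Finsupp.multinomial_eq]
  refine (Nat.div_le_self _ _).trans_eq ?_
  rw [← Multiset.toFinset_sum_count_eq m]
  rfl

lemma sum_range_pow_eq {R : Type*} [CommSemiring R] (z : ℕ → R) (N n : ℕ) :
    (∑ j ∈ Finset.range N, z j) ^ n =
      ∑ l ∈ sortedLists N 0 n, (l : Multiset ℕ).countPerms * (l.map z).prod :=
  (Finset.sum_pow z n).trans
    ((sum_sym_range N n fun m => (m.countPerms : R) * (m.map z).prod).trans (by simp))

/-- The product of the weights `w` of the consecutive gaps of the list `a :: l`. -/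
def gapProd (w : ℕ → ℝ) : ℕ → List ℕ → ℝ
  | _, [] => 1
  | a, b :: l => w (b - a) * gapProd w b l

lemma sum_gapProd_le {w : ℕ → ℝ} (hw : 0 ≤ w) (N n a : ℕ) :
    ∑ l ∈ sortedLists N a n, gapProd w a l ≤ (∑ r ∈ Finset.range N, w r) ^ n := by
  induction n generalizing a with
  | zero => simp [sortedLists, gapProd]
  | succ n ih =>
    have hS : 0 ≤ ∑ r ∈ Finset.range N, w r := Finset.sum_nonneg fun r _ => hw r
    have hgap : ∑ b ∈ Finset.Ico a N, w (b - a) ≤ ∑ r ∈ Finset.range N, w r := by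
      simp only [Finset.sum_Ico_eq_sum_range, Nat.add_sub_cancel_left]
      exact Finset.sum_le_sum_of_subset_of_nonneg (Finset.range_mono (Nat.sub_le N a))
        fun r _ _ => hw r
    calc ∑ l ∈ sortedLists N a (n + 1), gapProd w a l
        = ∑ b ∈ Finset.Ico a N, w (b - a) * ∑ l ∈ sortedLists N b n, gapProd w b l := by
          simp only [sum_sortedLists_succ, gapProd, Finset.mul_sum]
      _ ≤ ∑ b ∈ Finset.Ico a N, w (b - a) * (∑ r ∈ Finset.range N, w r) ^ n :=
          Finset.sum_le_sum fun b _ => mul_le_mul_of_nonneg_left (ih b) (hw _)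
      _ = (∑ b ∈ Finset.Ico a N, w (b - a)) * (∑ r ∈ Finset.range N, w r) ^ n :=
          (Finset.sum_mul ..).symm
      _ ≤ (∑ r ∈ Finset.range N, w r) ^ (n + 1) := by
          rw [pow_succ']
          gcongr

/-- The split is at the largest gap `r`: as `w` is antitone, `w r` is the least weight of a gap,
hence at most the geometric mean of all of them. -/
lemma exists_split_pow_le_gapProd {w : ℕ → ℝ} (hw : 0 ≤ w) (hanti : Antitone w) {l : List ℕ}
    (hl : l ≠ []) {a : ℕ} (hsorted : (a :: l).Pairwise (· ≤ ·)) :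
    ∃ l₁ l₂ : List ℕ, ∃ c r : ℕ, l = l₁ ++ l₂ ∧ l₂ ≠ [] ∧ (∀ i ∈ a :: l₁, i ≤ c) ∧
      (∀ i ∈ l₂, c + r ≤ i) ∧ w r ^ l.length ≤ gapProd w a l := by
  induction l generalizing a with
  | nil => contradiction
  | cons b l ih =>
    obtain ⟨hab, htail⟩ := List.pairwise_cons.1 hsorted
    have hb : ∀ i ∈ b :: l, b ≤ i := by simpa using (List.pairwise_cons.1 htail).1
    have hab' : a ≤ b := hab b List.mem_cons_self
    have split_here : w (b - a) ^ l.length ≤ gapProd w b l →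
        ∃ l₁ l₂ : List ℕ, ∃ c r : ℕ, b :: l = l₁ ++ l₂ ∧ l₂ ≠ [] ∧ (∀ i ∈ a :: l₁, i ≤ c) ∧
          (∀ i ∈ l₂, c + r ≤ i) ∧ w r ^ (b :: l).length ≤ gapProd w a (b :: l) := fun h =>
      ⟨[], b :: l, a, b - a, rfl, hl, by simp, fun i hi => by have := hb i hi; omega, by
        rw [List.length_cons, pow_succ']
        exact mul_le_mul_of_nonneg_left h (hw _)⟩
    rcases eq_or_ne l [] with rfl | hl'
    · exact split_here (by simp [gapProd])
    obtain ⟨l₁, l₂, c, r, rfl, hl₂, hc, hr, hle⟩ := ih hl' htail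
    rcases le_total (b - a) r with hgap | hgap
    · refine ⟨b :: l₁, l₂, c, r, rfl, hl₂, ?_, hr, ?_⟩
      · exact List.forall_mem_cons.2 ⟨hab'.trans (hc b List.mem_cons_self), hc⟩
      · rw [List.length_cons, pow_succ']
        exact mul_le_mul (hanti hgap) hle (pow_nonneg (hw _) _) (hw _)
    · exact split_here ((pow_le_pow_left₀ (hw _) (hanti hgap) _).trans hle)

/-- Joint moments `e`, indexed by lists of times, factorize up to an error `γ r` over two groups of
times in `[0, N)` that are separated by a gap `r`. -/
def AlmostMultiplicative (N : ℕ) (γ : ℕ → ℝ) (e : List ℕ → ℝ) : Prop :=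
  ∀ (l₁ l₂ : List ℕ) (c r : ℕ), r < N → (∀ i ∈ l₁, i ≤ c) → (∀ i ∈ l₂, c + r ≤ i) →
    |e (l₁ ++ l₂) - e l₁ * e l₂| ≤ γ r

/-- The sum of the absolute values of `e` over the nondecreasing lists of length `n` with entries in
`[0, N)`. -/
def absMomentSum (N : ℕ) (e : List ℕ → ℝ) (n : ℕ) : ℝ :=
  ∑ l ∈ sortedLists N 0 n, |e l|

lemma absMomentSum_nonneg (N : ℕ) (e : List ℕ → ℝ) (n : ℕ) : 0 ≤ absMomentSum N e n :=
  Finset.sum_nonneg fun _ _ => abs_nonneg _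

lemma sum_abs_mul_split_le (N : ℕ) (e : List ℕ → ℝ) {m n : ℕ} (hmn : m ≤ n) :
    ∑ l ∈ sortedLists N 0 n, |e (l.take m)| * |e (l.drop m)| ≤
      absMomentSum N e m * absMomentSum N e (n - m) := by
  simp only [absMomentSum, Finset.sum_mul_sum, ← Finset.sum_product']
  have hinj : Set.InjOn (fun l : List ℕ => (l.take m, l.drop m)) (sortedLists N 0 n) :=
    fun l _ l' _ h => by
      rw [← List.take_append_drop m l, ← List.take_append_drop m l', (Prod.mk.inj h).1,
        (Prod.mk.inj h).2]
  rw [← Finset.sum_image (f := fun p : List ℕ × List ℕ => |e p.1| * |e p.2|) hinj]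
  refine Finset.sum_le_sum_of_subset_of_nonneg ?_ fun p _ _ => by positivity
  simp only [Finset.subset_iff, Finset.mem_image, Finset.mem_product, mem_sortedLists]
  rintro _ ⟨l, ⟨hlen, hs, hN⟩, rfl⟩
  have hs' := (List.pairwise_cons.1 hs).2
  refine ⟨⟨by simp [hlen, hmn], List.pairwise_cons.2 ⟨by simp, hs'.take⟩,
    fun i hi => hN i (List.mem_of_mem_take hi)⟩, by simp [hlen],
    List.pairwise_cons.2 ⟨by simp, hs'.drop⟩, fun i hi => hN i (List.mem_of_mem_drop hi)⟩

lemma AlmostMultiplicative.abs_cons_le {N : ℕ} {γ w : ℕ → ℝ} {e : List ℕ → ℝ}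
    (he : AlmostMultiplicative N γ e) (hw : 0 ≤ w) (hanti : Antitone w) {a : ℕ} {l : List ℕ}
    (hl : l ≠ []) (hsorted : (a :: l).Pairwise (· ≤ ·)) (hN : ∀ i ∈ l, i < N) {B : ℝ} (hB : 0 ≤ B)
    (hγ : ∀ r < N, γ r ≤ B * w r ^ l.length) :
    |e (a :: l)| ≤ ∑ m ∈ Finset.Ico 1 (l.length + 1),
      |e ((a :: l).take m)| * |e ((a :: l).drop m)| + B * gapProd w a l := by
  obtain ⟨l₁, l₂, c, r, rfl, hl₂, hc, hr, hle⟩ := exists_split_pow_le_gapProd hw hanti hl hsorted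
  obtain ⟨i, hi⟩ := List.exists_mem_of_ne_nil l₂ hl₂
  have hrN : r < N := by have := hr i hi; have := hN i (by simp [hi]); omega
  have hsplit : |e (a :: l₁)| * |e l₂| ≤ ∑ m ∈ Finset.Ico 1 ((l₁ ++ l₂).length + 1),
      |e ((a :: (l₁ ++ l₂)).take m)| * |e ((a :: (l₁ ++ l₂)).drop m)| := by
    have hm : l₁.length + 1 ∈ Finset.Ico 1 ((l₁ ++ l₂).length + 1) := by
      have := List.length_pos_of_ne_nil hl₂
      simp only [Finset.mem_Ico, List.length_append]
      omega
    refine le_of_eq_of_le ?_ (Finset.single_le_sum (fun m _ => by positivity) hm)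
    simp
  calc |e (a :: (l₁ ++ l₂))|
      = |e (a :: l₁) * e l₂ + (e (a :: l₁ ++ l₂) - e (a :: l₁) * e l₂)| := by
        rw [add_sub_cancel, List.cons_append]
    _ ≤ |e (a :: l₁)| * |e l₂| + γ r :=
        (abs_add_le _ _).trans (add_le_add (abs_mul _ _).le (he _ _ c r hrN hc hr))
    _ ≤ _ := add_le_add hsplit ((hγ r hrN).trans (mul_le_mul_of_nonneg_left hle hB))

lemma AlmostMultiplicative.absMomentSum_le {N : ℕ} {γ w : ℕ → ℝ} {e : List ℕ → ℝ}
    (he : AlmostMultiplicative N γ e) (hw : 0 ≤ w) (hanti : Antitone w) {n : ℕ} (hn : 2 ≤ n)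
    {B : ℝ} (hB : 0 ≤ B) (hγ : ∀ r < N, γ r ≤ B * w r ^ (n - 1)) :
    absMomentSum N e n ≤
      ∑ m ∈ Finset.Ico 1 n, absMomentSum N e m * absMomentSum N e (n - m) +
        B * (N * (∑ r ∈ Finset.range N, w r) ^ (n - 1)) := by
  obtain ⟨n, rfl⟩ : ∃ n', n = n' + 1 := ⟨n - 1, by omega⟩
  rw [Nat.add_sub_cancel] at hγ ⊢
  have hterm : ∀ a ∈ Finset.Ico 0 N, ∀ l ∈ sortedLists N a n, |e (a :: l)| ≤
      ∑ m ∈ Finset.Ico 1 (n + 1), |e ((a :: l).take m)| * |e ((a :: l).drop m)| +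
        B * gapProd w a l := by
    intro a _ l hl
    obtain ⟨rfl, hs, hN⟩ := mem_sortedLists.1 hl
    exact he.abs_cons_le hw hanti (List.ne_nil_of_length_pos (by omega)) hs hN hB hγ
  have hgap : ∑ a ∈ Finset.Ico 0 N, ∑ l ∈ sortedLists N a n, gapProd w a l ≤
      N * (∑ r ∈ Finset.range N, w r) ^ n := by
    simpa using Finset.sum_le_card_nsmul (Finset.Ico 0 N) _ _ fun a _ => sum_gapProd_le hw N n a
  calc absMomentSum N e (n + 1)
      = ∑ a ∈ Finset.Ico 0 N, ∑ l ∈ sortedLists N a n, |e (a :: l)| := sum_sortedLists_succ ..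
    _ ≤ ∑ a ∈ Finset.Ico 0 N, ∑ l ∈ sortedLists N a n,
          (∑ m ∈ Finset.Ico 1 (n + 1), |e ((a :: l).take m)| * |e ((a :: l).drop m)| +
            B * gapProd w a l) :=
        Finset.sum_le_sum fun a ha => Finset.sum_le_sum (hterm a ha)
    _ = ∑ m ∈ Finset.Ico 1 (n + 1), ∑ l ∈ sortedLists N 0 (n + 1), |e (l.take m)| * |e (l.drop m)| +
          B * ∑ a ∈ Finset.Ico 0 N, ∑ l ∈ sortedLists N a n, gapProd w a l := by
        rw [Finset.sum_comm, sum_sortedLists_succ]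
        simp only [Finset.sum_add_distrib, Finset.mul_sum]
    _ ≤ _ := add_le_add (Finset.sum_le_sum fun m hm =>
          sum_abs_mul_split_le N e (Finset.mem_Ico.1 hm).2.le)
        (mul_le_mul_of_nonneg_left hgap hB)

lemma sum_range_inv_sq_le_two (N : ℕ) : ∑ r ∈ Finset.range N, 1 / ((r : ℝ) + 1) ^ 2 ≤ 2 := by
  have h := sum_Ioo_inv_sq_le (α := ℝ) 0 (N + 1)
  have hIoo : Finset.Ioo 0 (N + 1) = (Finset.range N).map (addRightEmbedding 1) := by
    ext i
    simp only [Finset.mem_Ioo, Finset.mem_map, Finset.mem_range, addRightEmbedding_apply]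
    exact ⟨fun h => ⟨i - 1, by omega⟩, by omega⟩
  simpa [hIoo] using h

lemma sum_range_rpow_sub_one_le {q : ℝ} (hq0 : 0 < q) (hq1 : q ≤ 1) (N : ℕ) :
    ∑ r ∈ Finset.range N, ((r : ℝ) + 1) ^ (q - 1) ≤ (N : ℝ) ^ q / q := by
  induction N with
  | zero => simp [hq0.ne']
  | succ N ih =>
    have hN : (0 : ℝ) < N + 1 := by positivity
    have bernoulli : (1 + -1 / (N + 1 : ℝ)) ^ q ≤ 1 + q * (-1 / (N + 1)) :=
      rpow_one_add_le_one_add_mul_self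
        (by rw [le_div_iff₀ hN]; linarith [N.cast_nonneg (α := ℝ)]) hq0.le hq1
    have hle : (N : ℝ) ^ q + q * ((N : ℝ) + 1) ^ (q - 1) ≤ ((N : ℝ) + 1) ^ q :=
      calc (N : ℝ) ^ q + q * ((N : ℝ) + 1) ^ (q - 1)
          = (N + 1 : ℝ) ^ q * (1 + -1 / (N + 1 : ℝ)) ^ q + q * ((N : ℝ) + 1) ^ (q - 1) := by
            rw [← Real.mul_rpow hN.le (by field_simp; simp)]
            congr 2
            field_simp
            ring
        _ ≤ (N + 1 : ℝ) ^ q * (1 + q * (-1 / (N + 1))) + q * ((N : ℝ) + 1) ^ (q - 1) := by gcongr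
        _ = ((N : ℝ) + 1) ^ q := by
            rw [Real.rpow_sub_one hN.ne']
            ring
    rw [Finset.sum_range_succ, Nat.cast_succ]
    calc _ ≤ (N : ℝ) ^ q / q + ((N : ℝ) + 1) ^ (q - 1) := by gcongr
      _ = ((N : ℝ) ^ q + q * ((N : ℝ) + 1) ^ (q - 1)) / q := by field_simp
      _ ≤ _ := by gcongr

lemma exists_gap_weight_of_three_le {n : ℕ} (hn : 3 ≤ n) (N : ℕ) :
    ∃ w : ℕ → ℝ, 0 ≤ w ∧ Antitone w ∧
      (∀ r : ℕ, w r ^ (n - 1) = ((r : ℝ) + 1) ^ (-(n / 2 : ℝ))) ∧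
      N * (∑ r ∈ Finset.range N, w r) ^ (n - 1) ≤ 4 ^ (n - 1) * √N ^ n := by
  obtain ⟨m, rfl⟩ : ∃ m, n = m + 1 := ⟨n - 1, by omega⟩
  have hm : (2 : ℝ) ≤ m := by exact_mod_cast (by omega : 2 ≤ m)
  rw [Nat.add_sub_cancel]
  set q : ℝ := (m - 1) / (2 * m) with hq
  have hq4 : 1 / 4 ≤ q := by rw [hq, div_le_div_iff₀ (by norm_num) (by positivity)]; linarith
  have hq1 : q ≤ 1 := by rw [hq, div_le_one (by positivity)]; linarith
  have hqm : q * m = (m - 1) / 2 := by rw [hq]; field_simp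
  refine ⟨fun r => ((r : ℝ) + 1) ^ (q - 1), fun r => by positivity, fun r s hrs => ?_,
    fun r => ?_, ?_⟩
  · exact Real.rpow_le_rpow_of_nonpos (by positivity) (by gcongr) (by linarith)
  · rw [← Real.rpow_mul_natCast (by positivity), sub_mul, hqm]
    congr 1
    push_cast
    ring
  rcases Nat.eq_zero_or_pos N with rfl | hN
  · simp
  have hN0 : (0 : ℝ) < N := by exact_mod_cast hN
  calc N * (∑ r ∈ Finset.range N, ((r : ℝ) + 1) ^ (q - 1)) ^ m
      ≤ N * (4 * (N : ℝ) ^ q) ^ m := by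
        gcongr
        refine (sum_range_rpow_sub_one_le (by linarith) hq1 N).trans ?_
        rw [div_le_iff₀ (by linarith)]
        nlinarith [Real.rpow_nonneg hN0.le q]
    _ = 4 ^ m * ((N : ℝ) ^ (1 : ℝ) * (N : ℝ) ^ (q * m)) := by
        rw [mul_pow, Real.rpow_mul_natCast hN0.le, Real.rpow_one]
        ring
    _ = 4 ^ m * √N ^ (m + 1) := by
        rw [← Real.rpow_add hN0, hqm, Real.sqrt_eq_rpow, ← Real.rpow_mul_natCast hN0.le]
        push_cast
        ring_nf

lemma exists_gap_weight {k n : ℕ} (hk : 2 ≤ k) (hn : 2 ≤ n) (hnk : n ≤ 2 * k) (N : ℕ) :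
    ∃ w : ℕ → ℝ, 0 ≤ w ∧ Antitone w ∧ (∀ r : ℕ, 1 / ((r : ℝ) + 1) ^ k ≤ w r ^ (n - 1)) ∧
      N * (∑ r ∈ Finset.range N, w r) ^ (n - 1) ≤ 4 ^ (n - 1) * √N ^ n := by
  rcases hn.eq_or_lt with rfl | hn
  · refine ⟨fun r => 1 / ((r : ℝ) + 1) ^ 2, fun r => by positivity, fun r s hrs => by dsimp; gcongr,
      fun r => ?_, ?_⟩
    · simp only [Nat.add_one_sub_one, pow_one]
      gcongr
      simp
    · rw [Nat.add_one_sub_one, Real.sq_sqrt N.cast_nonneg, pow_one, pow_one]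
      nlinarith [sum_range_inv_sq_le_two N, N.cast_nonneg (α := ℝ)]
  · obtain ⟨w, hw, hanti, hpow, hsum⟩ := exists_gap_weight_of_three_le hn N
    refine ⟨w, hw, hanti, fun r => ?_, hsum⟩
    rw [hpow, one_div, ← Real.rpow_natCast, ← Real.rpow_neg (by positivity)]
    have : (n : ℝ) ≤ 2 * k := by exact_mod_cast hnk
    exact Real.rpow_le_rpow_of_exponent_le (by simp) (by linarith)

/-- The constants in the bounds `absMomentSum N e n ≤ momentConst n * B * √N ^ n`: the Catalan-like
recursion comes from cutting lists of times in two. -/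
def momentConst (n : ℕ) : ℝ :=
  4 ^ n + ∑ m ∈ (Finset.Ico 1 n).attach, momentConst m * momentConst (n - m)
decreasing_by all_goals have := Finset.mem_Ico.1 m.2; omega

lemma momentConst_eq (n : ℕ) :
    momentConst n = 4 ^ n + ∑ m ∈ Finset.Ico 1 n, momentConst m * momentConst (n - m) := by
  rw [momentConst, Finset.sum_attach _ fun m => momentConst m * momentConst (n - m)]

lemma momentConst_pos (n : ℕ) : 0 < momentConst n := by
  induction n using Nat.strong_induction_on with
  | _ n ih =>
    rw [momentConst_eq]
    refine add_pos_of_pos_of_nonneg (by positivity) (Finset.sum_nonneg fun m hm => ?_)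
    rw [Finset.mem_Ico] at hm
    exact mul_nonneg (ih m hm.2).le (ih (n - m) (by omega)).le

lemma sum_mul_reflect_le {a c : ℕ → ℝ} (ha : ∀ m, 0 ≤ a m) (hc : ∀ m, 0 ≤ c m) {B s : ℝ}
    (hB0 : 0 ≤ B) (hB1 : B ≤ 1) (hs : 0 ≤ s) {n : ℕ}
    (hac : ∀ m ∈ Finset.Ico 1 n, a m ≤ c m * B * s ^ m) :
    ∑ m ∈ Finset.Ico 1 n, a m * a (n - m) ≤
      (∑ m ∈ Finset.Ico 1 n, c m * c (n - m)) * (B * s ^ n) := by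
  rw [Finset.sum_mul]
  refine Finset.sum_le_sum fun m hm => ?_
  have hm' : n - m ∈ Finset.Ico 1 n := by rw [Finset.mem_Ico] at hm ⊢; omega
  have hcm := mul_nonneg (hc m) (hc (n - m))
  calc a m * a (n - m) ≤ (c m * B * s ^ m) * (c (n - m) * B * s ^ (n - m)) :=
        mul_le_mul (hac m hm) (hac _ hm') (ha _) ((ha m).trans (hac m hm))
    _ = c m * c (n - m) * (B * B * s ^ (m + (n - m))) := by ring
    _ ≤ c m * c (n - m) * (B * s ^ n) := by
        rw [Nat.add_sub_of_le (Finset.mem_Ico.1 hm).2.le]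
        gcongr
        exact mul_le_of_le_one_left hB0 hB1

lemma AlmostMultiplicative.absMomentSum_le_momentConst_mul {k : ℕ} (hk : 2 ≤ k) {N : ℕ} {B : ℝ}
    (hB0 : 0 ≤ B) (hB1 : B ≤ 1) {e : List ℕ → ℝ}
    (he : AlmostMultiplicative N (fun r => B / ((r : ℝ) + 1) ^ k) e) (hcenter : ∀ i, e [i] = 0)
    {n : ℕ} (hn : 1 ≤ n) (hnk : n ≤ 2 * k) :
    absMomentSum N e n ≤ momentConst n * B * √N ^ n := by
  induction n using Nat.strong_induction_on with
  | _ n ih =>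
    rcases hn.eq_or_lt with rfl | hn
    · rw [absMomentSum, sum_sortedLists_succ]
      simp only [sortedLists, Finset.sum_singleton, hcenter, abs_zero, Finset.sum_const_zero]
      have := momentConst_pos 1
      positivity
    obtain ⟨w, hw, hanti, hpow, hsum⟩ := exists_gap_weight hk hn hnk N
    have hconv : ∑ m ∈ Finset.Ico 1 n, absMomentSum N e m * absMomentSum N e (n - m) ≤
        (∑ m ∈ Finset.Ico 1 n, momentConst m * momentConst (n - m)) * (B * √N ^ n) :=
      sum_mul_reflect_le (absMomentSum_nonneg N e) (fun m => (momentConst_pos m).le) hB0 hB1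
        (Real.sqrt_nonneg _) fun m hm => ih m (Finset.mem_Ico.1 hm).2 (Finset.mem_Ico.1 hm).1
          ((Finset.mem_Ico.1 hm).2.le.trans hnk)
    calc absMomentSum N e n
        ≤ ∑ m ∈ Finset.Ico 1 n, absMomentSum N e m * absMomentSum N e (n - m) +
            B * (N * (∑ r ∈ Finset.range N, w r) ^ (n - 1)) :=
          he.absMomentSum_le hw hanti hn hB0 fun r _ => by
            rw [div_eq_mul_one_div]
            exact mul_le_mul_of_nonneg_left (hpow r) hB0
      _ ≤ (∑ m ∈ Finset.Ico 1 n, momentConst m * momentConst (n - m)) * (B * √N ^ n) +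
            B * (4 ^ n * √N ^ n) := by
          refine add_le_add hconv (mul_le_mul_of_nonneg_left (hsum.trans ?_) hB0)
          gcongr
          · norm_num
          · omega
      _ = momentConst n * B * √N ^ n := by
          rw [momentConst_eq n]
          ring

/-! ### Moments of time integrals -/

section jointMoment

variable {Ω ι : Type*} {Z : ι → Ω → ℝ}

lemma measurable_prod_map {m : MeasurableSpace Ω} {l : List ι} (hZ : ∀ i ∈ l, Measurable (Z i)) :
    Measurable fun ω => (l.map (Z · ω)).prod := by
  induction l with
  | nil => simp
  | cons i l ih =>
    simp only [List.map_cons, List.prod_cons]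
    exact (hZ i (by simp)).mul (ih fun j hj => hZ j (by simp [hj]))

lemma abs_prod_map_le_one {f : ι → ℝ} (hf : ∀ i, |f i| ≤ 1) (l : List ι) :
    |(l.map f).prod| ≤ 1 := by
  induction l with
  | nil => simp
  | cons i l ih =>
    rw [List.map_cons, List.prod_cons, abs_mul]
    exact mul_le_one₀ (hf i) (abs_nonneg _) ih

variable [MeasurableSpace Ω]

/-- The joint moment `E[Z_{i₁} ⋯ Z_{iₙ}]` of the family `Z` along the list `[i₁, …, iₙ]`. -/
noncomputable def jointMoment (P : Measure Ω) (Z : ι → Ω → ℝ) (l : List ι) : ℝ :=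
  ∫ ω, (l.map (Z · ω)).prod ∂P

variable {P : Measure Ω} [IsProbabilityMeasure P]

lemma integrable_prod_map (hZ : ∀ i, Measurable (Z i)) (hZ1 : ∀ i ω, |Z i ω| ≤ 1) (l : List ι) :
    Integrable (fun ω => (l.map (Z · ω)).prod) P :=
  .of_bound (measurable_prod_map fun i _ => hZ i).aestronglyMeasurable 1
    (ae_of_all _ fun ω => abs_prod_map_le_one (hZ1 · ω) l)

lemma integral_sum_range_pow_le {Z : ℕ → Ω → ℝ} (hZ : ∀ i, Measurable (Z i))
    (hZ1 : ∀ i ω, |Z i ω| ≤ 1) (N n : ℕ) :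
    ∫ ω, (∑ j ∈ Finset.range N, Z j ω) ^ n ∂P ≤
      n.factorial * absMomentSum N (jointMoment P Z) n := by
  simp only [sum_range_pow_eq]
  rw [integral_finsetSum _ fun l _ => (integrable_prod_map hZ hZ1 l).const_mul _, absMomentSum,
    Finset.mul_sum]
  refine Finset.sum_le_sum fun l hl => ?_
  rw [integral_const_mul, ← jointMoment]
  have hlen : (l : Multiset ℕ).card = n := (mem_sortedLists.1 hl).1
  refine (mul_le_mul_of_nonneg_left (le_abs_self _) (Nat.cast_nonneg _)).trans ?_
  gcongr
  exact (countPerms_le_factorial _).trans_eq (by rw [hlen])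

theorem integral_sum_range_pow_le_of_almostMultiplicative {Z : ℕ → Ω → ℝ}
    (hZ : ∀ i, Measurable (Z i)) (hZ1 : ∀ i ω, |Z i ω| ≤ 1) (hcenter : ∀ i, ∫ ω, Z i ω ∂P = 0)
    {k : ℕ} (hk : 2 ≤ k) {N : ℕ} {B : ℝ} (hB0 : 0 ≤ B) (hB1 : B ≤ 1)
    (hmul : AlmostMultiplicative N (fun r => B / ((r : ℝ) + 1) ^ k) (jointMoment P Z)) :
    ∫ ω, (∑ j ∈ Finset.range N, Z j ω) ^ (2 * k) ∂P ≤
      (2 * k).factorial * momentConst (2 * k) * B * N ^ k :=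
  calc ∫ ω, (∑ j ∈ Finset.range N, Z j ω) ^ (2 * k) ∂P
      ≤ (2 * k).factorial * absMomentSum N (jointMoment P Z) (2 * k) :=
        integral_sum_range_pow_le hZ hZ1 N (2 * k)
    _ ≤ (2 * k).factorial * (momentConst (2 * k) * B * √N ^ (2 * k)) := by
        gcongr
        exact hmul.absMomentSum_le_momentConst_mul hk hB0 hB1 (by simpa [jointMoment]) (by omega)
          le_rfl
    _ = (2 * k).factorial * momentConst (2 * k) * B * N ^ k := by
        rw [pow_mul, Real.sq_sqrt N.cast_nonneg]
        ring

end jointMoment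

section timeIntegral

lemma integral_pow_integral_le {Ω Ω' : Type*} [MeasurableSpace Ω] [MeasurableSpace Ω']
    {P : Measure Ω} [IsProbabilityMeasure P] {ν : Measure Ω'} [IsProbabilityMeasure ν]
    {S : Ω → Ω' → ℝ} (hS : Measurable (Function.uncurry S)) {c : ℝ} (hc : ∀ ω x, |S ω x| ≤ c)
    {n : ℕ} (hn : Even n) {B : ℝ} (hB : ∀ x, ∫ ω, S ω x ^ n ∂P ≤ B) :
    ∫ ω, (∫ x, S ω x ∂ν) ^ n ∂P ≤ B := by
  have hpow : ∀ ω x, ‖S ω x ^ n‖ ≤ c ^ n := fun ω x => by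
    rw [norm_pow]
    exact pow_le_pow_left₀ (norm_nonneg _) (hc ω x) n
  have hint : Integrable (Function.uncurry fun ω x => S ω x ^ n) (P.prod ν) :=
    .of_bound (hS.pow_const n).aestronglyMeasurable (c ^ n) (ae_of_all _ fun p => hpow p.1 p.2)
  have jensen : ∀ ω, (∫ x, S ω x ∂ν) ^ n ≤ ∫ x, S ω x ^ n ∂ν := fun ω => by
    have hm : Measurable (S ω) := hS.of_uncurry_left
    exact hn.convexOn_pow.map_integral_le (continuous_pow n).continuousOn isClosed_univ (by simp)
      (.of_bound hm.aestronglyMeasurable c (ae_of_all _ (hc ω)))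
      (.of_bound (hm.pow_const n).aestronglyMeasurable (c ^ n) (ae_of_all _ (hpow ω)))
  calc ∫ ω, (∫ x, S ω x ∂ν) ^ n ∂P
      ≤ ∫ ω, ∫ x, S ω x ^ n ∂ν ∂P :=
        integral_mono_of_nonneg (ae_of_all _ fun ω => hn.pow_nonneg _) hint.integral_prod_left
          (ae_of_all _ jensen)
    _ = ∫ x, ∫ ω, S ω x ^ n ∂P ∂ν := integral_integral_swap hint
    _ ≤ ∫ _, B ∂ν := integral_mono hint.integral_prod_right (integrable_const B) hB
    _ = B := by simp

lemma intervalIntegral_eq_mul_integral_sum {f : ℝ → ℝ} (hf : Measurable f) {c : ℝ}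
    (hc : ∀ x, |f x| ≤ c) (h : ℝ) (N : ℕ) :
    ∫ s in (0 : ℝ)..N * h, f s =
      h * ∫ x in (0 : ℝ)..1, ∑ j ∈ Finset.range N, f (h * x + j * h) := by
  have hint {g : ℝ → ℝ} (hg : Measurable g) (hgc : ∀ x, |g x| ≤ c) (a b : ℝ) :
      IntervalIntegrable g volume a b :=
    (intervalIntegrable_const (c := c)).mono_fun hg.aestronglyMeasurable
      (ae_of_all _ fun x => by simpa using (hgc x).trans (le_abs_self c))
  have hsum := intervalIntegral.sum_integral_adjacent_intervals (f := f) (μ := volume) (n := N)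
    (a := fun j : ℕ => (j : ℝ) * h) fun j _ => hint hf hc _ _
  simp only [Nat.cast_zero, zero_mul] at hsum
  rw [intervalIntegral.integral_finsetSum fun j _ => hint (by fun_prop) (fun x => hc _) _ _,
    Finset.mul_sum, ← hsum]
  refine Finset.sum_congr rfl fun j _ => ?_
  rw [intervalIntegral.mul_integral_comp_mul_add]
  congr 1 <;> push_cast <;> ring

lemma exists_mesh_mul_eq {ℓ t : ℝ} (hℓ : 0 < ℓ) (ht : 0 < t) :
    ∃ (h : ℝ≥0) (N : ℕ), N * (h : ℝ) = t ∧ h ≤ 2 * ℓ ∧ (1 < N → ℓ ≤ h) := by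
  set N : ℕ := ⌈t / (2 * ℓ)⌉₊
  have hN : 0 < N := Nat.ceil_pos.2 (by positivity)
  have hN0 : (0 : ℝ) < N := by exact_mod_cast hN
  have hle : t ≤ N * (2 * ℓ) := (div_le_iff₀ (by positivity)).1 (Nat.le_ceil _)
  have hlt : (N : ℝ) < t / (2 * ℓ) + 1 := Nat.ceil_lt_add_one (by positivity)
  refine ⟨⟨t / N, by positivity⟩, N, mul_div_cancel₀ t hN0.ne', ?_, fun hN1 => ?_⟩
  · exact (div_le_iff₀ hN0).2 (by linarith)
  · have hN2 : (2 : ℝ) ≤ N := by exact_mod_cast hN1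
    rw [← sub_lt_iff_lt_add, lt_div_iff₀ (by positivity)] at hlt
    exact (le_div_iff₀ hN0).2 (by nlinarith)

variable {Ω E : Type*} [MeasurableSpace Ω] [MeasurableSpace E] {X : ℝ≥0 → Ω → E} {v : E → ℝ}

lemma measurable_timeIntegral (hX : Measurable fun p : ℝ≥0 × Ω => X p.1 p.2)
    (hv : Measurable v) (t : ℝ) : Measurable fun ω => ∫ s in (0 : ℝ)..t, v (X s.toNNReal ω) := by
  have h : Measurable fun p : Ω × ℝ => v (X p.2.toNNReal p.1) :=
    hv.comp (hX.comp (measurable_snd.real_toNNReal.prodMk measurable_fst))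
  simp only [intervalIntegral]
  exact (h.stronglyMeasurable.integral_prod_right' (ν := volume.restrict (Set.Ioc 0 t))
    ).measurable.sub (h.stronglyMeasurable.integral_prod_right'
      (ν := volume.restrict (Set.Ioc t 0))).measurable

lemma integral_pow_timeIntegral_le {P : Measure Ω} [IsProbabilityMeasure P]
    (hX : Measurable fun p : ℝ≥0 × Ω => X p.1 p.2) (hv : Measurable v) (hv1 : ∀ x, |v x| ≤ 1)
    (h : ℝ≥0) (N : ℕ) {n : ℕ} (hn : Even n) {B : ℝ}
    (hB : ∀ u : ℝ≥0, ∫ ω, (∑ j ∈ Finset.range N, v (X (u + j * h) ω)) ^ n ∂P ≤ B) :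
    ∫ ω, (∫ s in (0 : ℝ)..N * h, v (X s.toNNReal ω)) ^ n ∂P ≤ (h : ℝ) ^ n * B := by
  let S : Ω → ℝ → ℝ := fun ω x => ∑ j ∈ Finset.range N, v (X ((h * x).toNNReal + j * h) ω)
  have hS : Measurable (Function.uncurry S) :=
    Finset.measurable_sum _ fun j _ => hv.comp (hX.comp
      (((measurable_snd.const_mul _).real_toNNReal.add_const _).prodMk measurable_fst))
  have hSN : ∀ ω x, |S ω x| ≤ N := fun ω x => by
    refine (Finset.abs_sum_le_sum_abs _ _).trans ?_
    simpa using Finset.sum_le_sum fun j (_ : j ∈ Finset.range N) =>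
      hv1 (X ((h * x).toNNReal + j * h) ω)
  have hgrid : ∀ ω, ∫ s in (0 : ℝ)..N * h, v (X s.toNNReal ω) =
      h * ∫ x in Set.Ioc (0 : ℝ) 1, S ω x := fun ω => by
    have hpath : Measurable fun s : ℝ => v (X s.toNNReal ω) :=
      hv.comp (hX.comp (measurable_real_toNNReal.prodMk measurable_const))
    rw [intervalIntegral_eq_mul_integral_sum hpath (fun s => hv1 _) h N,
      intervalIntegral.integral_of_le zero_le_one]
    congr 1
    refine setIntegral_congr_fun measurableSet_Ioc fun x hx => Finset.sum_congr rfl fun j _ => ?_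
    rw [Real.toNNReal_add (mul_nonneg h.coe_nonneg hx.1.le) (by positivity),
      Real.toNNReal_mul (Nat.cast_nonneg j), Real.toNNReal_natCast, Real.toNNReal_coe]
  have : IsProbabilityMeasure (volume.restrict (Set.Ioc (0 : ℝ) 1)) := ⟨by simp⟩
  simp only [hgrid, mul_pow]
  rw [integral_const_mul]
  gcongr
  exact integral_pow_integral_le hS hSN hn fun x => hB _

end timeIntegral

section moments

variable {Ω E : Type*} [MeasurableSpace Ω] [MeasurableSpace E] {X : ℝ≥0 → Ω → E} {P : Measure Ω}
  [IsProbabilityMeasure P]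

lemma almostMultiplicative_jointMoment (hX : ∀ t, Measurable (X t)) {v : E → ℝ}
    (hv : Measurable v) (hv1 : ∀ x, |v x| ≤ 1) (u h : ℝ≥0) {N : ℕ} {γ : ℕ → ℝ}
    (hγ : ∀ r < N, min 1 (4 * strongMixing X P (r * h)) ≤ γ r) :
    AlmostMultiplicative N γ (jointMoment P fun (i : ℕ) ω => v (X (u + i * h) ω)) := by
  intro l₁ l₂ c r hr hl₁ hl₂
  let Z : ℕ → Ω → ℝ := fun i ω => v (X (u + i * h) ω)
  have hZ : ∀ i, Measurable (Z i) := fun i => hv.comp (hX _)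
  have hZ1 : ∀ (l : List ℕ) ω, |(l.map (Z · ω)).prod| ≤ 1 := fun l ω =>
    abs_prod_map_le_one (fun i => hv1 _) l
  have hLp (l : List ℕ) : MemLp (fun ω => (l.map (Z · ω)).prod) 2 P :=
    .of_bound (measurable_prod_map fun i _ => hZ i).aestronglyMeasurable 1 (ae_of_all _ (hZ1 l))
  have hcov : jointMoment P Z (l₁ ++ l₂) - jointMoment P Z l₁ * jointMoment P Z l₂ =
      cov[fun ω => (l₁.map (Z · ω)).prod, fun ω => (l₂.map (Z · ω)).prod; P] := by
    rw [covariance_eq_sub (hLp l₁) (hLp l₂)]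
    simp [jointMoment]
  have hpast : Measurable[pastSigma X (u + c * h)] fun ω => (l₁.map (Z · ω)).prod :=
    measurable_prod_map fun i hi => hv.comp (measurable_pastSigma (by gcongr; exact hl₁ i hi))
  have hfuture : Measurable[futureSigma X (u + c * h + r * h)] fun ω => (l₂.map (Z · ω)).prod :=
    measurable_prod_map fun i hi => hv.comp (measurable_futureSigma (by
      rw [add_assoc, ← add_mul]
      gcongr
      exact_mod_cast hl₂ i hi))
  have hle_one : |cov[fun ω => (l₁.map (Z · ω)).prod, fun ω => (l₂.map (Z · ω)).prod; P]| ≤ 1 :=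
    (abs_covariance_le_of_mem_Icc (measurable_prod_map fun i _ => hZ i)
      (measurable_prod_map fun i _ => hZ i) (fun ω => abs_le.1 (hZ1 l₁ ω))
      fun ω => abs_le.1 (hZ1 l₂ ω)).trans_eq (by norm_num)
  exact hcov ▸ (le_min hle_one (abs_covariance_le_four_mul_strongMixing hX hpast hfuture
    (hZ1 l₁) (hZ1 l₂))).trans (hγ r hr)

lemma mixingMoment_nonneg (k : ℕ) {α : ℝ≥0 → ℝ} (hα : ∀ r, 0 ≤ α r) : 0 ≤ mixingMoment k α :=
  Real.iSup_nonneg fun r => mul_nonneg (by positivity) (hα r)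

lemma mul_le_mixingMoment {k : ℕ} {α : ℝ≥0 → ℝ} (hα : FiniteMixingMoment k α) (r : ℝ≥0) :
    (1 + (r : ℝ)) ^ k * α r ≤ mixingMoment k α :=
  le_ciSup hα r

lemma min_one_four_mul_le {k : ℕ} {α : ℝ≥0 → ℝ} (hα : ∀ r, 0 ≤ α r)
    (hM : FiniteMixingMoment k α) {ℓ : ℝ} (hℓ : 0 < ℓ)
    (hℓk : ℓ ^ k = max 1 (4 * 2 ^ k * mixingMoment k α)) {h : ℝ≥0} {r : ℕ}
    (hh : r ≠ 0 → ℓ ≤ h) :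
    min 1 (4 * α (r * h)) ≤ min 1 (4 * 2 ^ k * mixingMoment k α) / ((r : ℝ) + 1) ^ k := by
  have hM0 := mixingMoment_nonneg k hα
  rcases eq_or_ne r 0 with rfl | hr
  · have hα0 : α 0 ≤ mixingMoment k α := by simpa using mul_le_mixingMoment hM 0
    have : mixingMoment k α ≤ 2 ^ k * mixingMoment k α :=
      le_mul_of_one_le_left hM0 (one_le_pow₀ one_le_two)
    simp only [Nat.cast_zero, zero_mul, zero_add, one_pow, div_one]
    exact min_le_min le_rfl (by linarith)
  · have hr1 : (1 : ℝ) ≤ r := by exact_mod_cast Nat.one_le_iff_ne_zero.2 hr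
    have hstep : ((r : ℝ) + 1) * ℓ ≤ 2 * (1 + (r * h : ℝ≥0)) := by
      push_cast
      nlinarith [hh hr]
    refine (min_le_right _ _).trans ((le_div_iff₀ (by positivity)).2 ?_)
    refine le_of_mul_le_mul_right ?_ (pow_pos hℓ k)
    calc 4 * α (r * h) * ((r : ℝ) + 1) ^ k * ℓ ^ k
        = 4 * α (r * h) * (((r : ℝ) + 1) * ℓ) ^ k := by rw [mul_pow, mul_assoc]
      _ ≤ 4 * α (r * h) * (2 * (1 + (r * h : ℝ≥0))) ^ k := by
          have := hα (r * h)
          gcongr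
      _ = 4 * 2 ^ k * ((1 + (r * h : ℝ≥0)) ^ k * α (r * h)) := by rw [mul_pow]; ring
      _ ≤ 4 * 2 ^ k * mixingMoment k α := by gcongr; exact mul_le_mixingMoment hM _
      _ = min 1 (4 * 2 ^ k * mixingMoment k α) * ℓ ^ k := by rw [hℓk, min_mul_max, one_mul]

/-- The constant in the bound of order `t ^ k` for the `2k`-th moment of centered time integrals up
to time `t`. -/
def timeMomentConst (k : ℕ) : ℝ :=
  4 ^ (k + 1) * (2 * k).factorial * momentConst (2 * k)

/-- The mesh `h` of the grid is of the order `max 1 M ^ (1 / k)` at which the mixing coefficients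
along the grid become of order one. -/
theorem integral_pow_timeIntegral_le_of_strongMixing_le {k : ℕ} (hk : 2 ≤ k)
    (hX : Measurable fun p : ℝ≥0 × Ω => X p.1 p.2) {μ : Measure E} (hμ : ∀ t, P.map (X t) = μ)
    {α : ℝ≥0 → ℝ} (hα : ∀ r, strongMixing X P r ≤ α r) (hM : FiniteMixingMoment k α)
    {v : E → ℝ} (hv : Measurable v) (hv1 : ∀ x, |v x| ≤ 1) (hv0 : ∫ x, v x ∂μ = 0)
    {t : ℝ} (ht : 0 < t) :
    ∫ ω, (∫ s in (0 : ℝ)..t, v (X s.toNNReal ω)) ^ (2 * k) ∂P ≤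
      timeMomentConst k * mixingMoment k α * t ^ k := by
  have hXt : ∀ t, Measurable (X t) := fun t => hX.of_uncurry_left
  have hα0 : ∀ r, 0 ≤ α r := fun r => (strongMixing_nonneg hXt r).trans (hα r)
  set M : ℝ := 4 * 2 ^ k * mixingMoment k α
  have hM0 : 0 ≤ M := mul_nonneg (by positivity) (mixingMoment_nonneg k hα0)
  set ℓ : ℝ := max 1 M ^ ((k : ℝ)⁻¹)
  have hℓ : 0 < ℓ := by positivity
  have hℓk : ℓ ^ k = max 1 M := Real.rpow_inv_natCast_pow (by positivity) (by omega)
  obtain ⟨h, N, hNh, hh, hℓh⟩ := exists_mesh_mul_eq hℓ ht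
  have hgrid (u : ℝ≥0) : ∫ ω, (∑ j ∈ Finset.range N, v (X (u + j * h) ω)) ^ (2 * k) ∂P ≤
      (2 * k).factorial * momentConst (2 * k) * min 1 M * N ^ k := by
    refine integral_sum_range_pow_le_of_almostMultiplicative (fun j => hv.comp (hXt _))
      (fun j ω => hv1 _) (fun j => ?_) hk (le_min zero_le_one hM0) (min_le_left _ _)
      (almostMultiplicative_jointMoment hXt hv hv1 u h fun r hr => ?_)
    · rw [← hv0, ← hμ (u + j * h)]
      exact (integral_map (hXt _).aemeasurable hv.aestronglyMeasurable).symm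
    · refine le_trans ?_ (min_one_four_mul_le hα0 hM hℓ hℓk fun hr0 => hℓh (by omega))
      exact min_le_min le_rfl (by linarith [hα (r * h)])
  have hconst := momentConst_pos (2 * k)
  calc ∫ ω, (∫ s in (0 : ℝ)..t, v (X s.toNNReal ω)) ^ (2 * k) ∂P
      ≤ (h : ℝ) ^ (2 * k) * ((2 * k).factorial * momentConst (2 * k) * min 1 M * N ^ k) :=
        hNh ▸ integral_pow_timeIntegral_le hX hv hv1 h N (even_two_mul k) hgrid
    _ = (2 * k).factorial * momentConst (2 * k) * min 1 M * h ^ k * t ^ k := by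
        rw [← hNh]
        ring
    _ ≤ (2 * k).factorial * momentConst (2 * k) * min 1 M * (2 * ℓ) ^ k * t ^ k := by gcongr
    _ = (2 * k).factorial * momentConst (2 * k) * 2 ^ k * (min 1 M * max 1 M) * t ^ k := by
        rw [mul_pow, hℓk]
        ring
    _ = timeMomentConst k * mixingMoment k α * t ^ k := by
        rw [min_mul_max, timeMomentConst, pow_succ, show (4 : ℝ) = 2 * 2 by norm_num, mul_pow]
        ring

/-- The constant in the deviation inequality. -/
def deviationConst (k : ℕ) : ℝ :=
  4 ^ k * timeMomentConst k

lemma deviationConst_pos (k : ℕ) : 0 < deviationConst k := by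
  have := momentConst_pos (2 * k)
  unfold deviationConst timeMomentConst
  positivity

lemma measureReal_le_abs_le_div {I : Ω → ℝ} (hI : Measurable I) {c : ℝ} (hc : ∀ ω, |I ω| ≤ c)
    {n : ℕ} (hn : Even n) {B : ℝ} (hB : ∫ ω, I ω ^ n ∂P ≤ B) {a : ℝ} (ha : 0 < a) :
    P.real {ω | a ≤ |I ω|} ≤ B / a ^ n := by
  have hint : Integrable (fun ω => I ω ^ n) P :=
    .of_bound (hI.pow_const n).aestronglyMeasurable (c ^ n) (ae_of_all _ fun ω => by
      rw [norm_pow]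
      exact pow_le_pow_left₀ (norm_nonneg _) (hc ω) n)
  have hmarkov := mul_meas_ge_le_integral_of_nonneg (ae_of_all P fun ω => hn.pow_nonneg (I ω))
    hint (a ^ n)
  rw [le_div_iff₀' (by positivity)]
  refine (mul_le_mul_of_nonneg_left (measureReal_mono fun ω (hω : a ≤ |I ω|) => ?_)
    (by positivity)).trans (hmarkov.trans hB)
  exact (pow_le_pow_left₀ ha.le hω n).trans_eq (hn.pow_abs (I ω))

lemma measureReal_le_abs_timeIntegral_le {k : ℕ} (hk : 2 ≤ k)
    (hX : Measurable fun p : ℝ≥0 × Ω => X p.1 p.2) {μ : Measure E} (hμ : ∀ t, P.map (X t) = μ)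
    {α : ℝ≥0 → ℝ} (hα : ∀ r, strongMixing X P r ≤ α r) (hM : FiniteMixingMoment k α)
    {v : E → ℝ} (hv : Measurable v) (hv1 : ∀ x, |v x| ≤ 1) (hv0 : ∫ x, v x ∂μ = 0)
    {t a : ℝ} (ht : 0 < t) (ha : 0 < a) :
    P.real {ω | a ≤ |∫ s in (0 : ℝ)..t, v (X s.toNNReal ω)|} ≤
      timeMomentConst k * mixingMoment k α * t ^ k / a ^ (2 * k) := by
  have hbound (ω : Ω) : |∫ s in (0 : ℝ)..t, v (X s.toNNReal ω)| ≤ 1 * |t - 0| :=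
    intervalIntegral.norm_integral_le_of_norm_le_const
      (f := fun s : ℝ => v (X s.toNNReal ω)) fun s _ => hv1 _
  exact measureReal_le_abs_le_div (measurable_timeIntegral hX hv t) hbound (even_two_mul k)
    (integral_pow_timeIntegral_le_of_strongMixing_le hk hX hμ hα hM hv hv1 hv0 ht) ha

theorem mainTheorem6_general {k : ℕ} (hk : 2 ≤ k) (hX : Measurable fun p : ℝ≥0 × Ω => X p.1 p.2)
    {μ : Measure E} (hμ : ∀ t, P.map (X t) = μ) {α : ℝ≥0 → ℝ}
    (hα : ∀ r, strongMixing X P r ≤ α r) (hM : FiniteMixingMoment k α) {V : E → ℝ}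
    (hV : Measurable V) (hV1 : ∀ x, |V x| ≤ 1) {R t : ℝ} (hR : 0 < R) (ht : 0 < t) :
    P.real {ω | R ≤ |1 / t * (∫ s in (0 : ℝ)..t, V (X s.toNNReal ω)) - ∫ x, V x ∂μ|} ≤
      deviationConst k * mixingMoment k α / (t ^ k * R ^ (2 * k)) := by
  have : IsProbabilityMeasure μ :=
    hμ 0 ▸ Measure.isProbabilityMeasure_map hX.of_uncurry_left.aemeasurable
  set m : ℝ := ∫ x, V x ∂μ
  have hm1 : |m| ≤ 1 := by
    simpa using norm_integral_le_of_norm_le_const (μ := μ) (f := V) (C := 1) (ae_of_all _ hV1)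
  let v : E → ℝ := fun x => (V x - m) / 2
  have hv1 : ∀ x, |v x| ≤ 1 := fun x => by
    rw [abs_div, abs_two]
    linarith [abs_sub (V x) m, hV1 x]
  have hv0 : ∫ x, v x ∂μ = 0 := by
    rw [integral_div, integral_sub (.of_bound hV.aestronglyMeasurable 1 (ae_of_all _ hV1))
      (integrable_const m)]
    simp [m]
  have hVpath (ω : Ω) : IntervalIntegrable (fun s : ℝ => V (X s.toNNReal ω)) volume 0 t :=
    (intervalIntegrable_const (c := (1 : ℝ))).mono_fun (hV.comp (hX.comp
      (measurable_real_toNNReal.prodMk measurable_const))).aestronglyMeasurable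
      (ae_of_all _ fun s => by simpa using hV1 _)
  have hcenter (ω : Ω) : 1 / t * (∫ s in (0 : ℝ)..t, V (X s.toNNReal ω)) - m =
      (∫ s in (0 : ℝ)..t, v (X s.toNNReal ω)) / (t / 2) := by
    rw [intervalIntegral.integral_div, intervalIntegral.integral_sub (hVpath ω) (by simp)]
    simp only [intervalIntegral.integral_const, sub_zero, smul_eq_mul]
    field_simp
  simp only [hcenter, abs_div, abs_of_pos (half_pos ht), le_div_iff₀ (half_pos ht)]
  refine (measureReal_le_abs_timeIntegral_le hk hX hμ hα hM ((hV.sub_const m).div_const 2) hv1 hv0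
    ht (by positivity)).trans_eq ?_
  rw [deviationConst, show (4 : ℝ) = 2 ^ 2 by norm_num, ← pow_mul, mul_pow, div_pow, two_mul k,
    pow_add t]
  field_simp

end moments

lemma sub_one_sub_floor_div_mem_Ioc {R t : ℝ} (ht : 0 < t) (hRt : t * (1 - R) < ⌊t⌋₊) :
    R - (1 - ⌊t⌋₊ / t) ∈ Set.Ioc 0 R := by
  have h1 : ⌊t⌋₊ / t ≤ 1 := div_le_one_of_le₀ (Nat.floor_le ht.le) ht.le
  have h2 : 1 - R < ⌊t⌋₊ / t := (lt_div_iff₀' ht).2 hRt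
  constructor <;> linarith

theorem mainTheorem6 (k : ℕ) (hk : 2 ≤ k) :
    ∃ C : ℝ, 0 < C ∧
      ∀ (Ω : Type*) (E : Type*) [MeasurableSpace Ω]
        [TopologicalSpace E] [PolishSpace E] [MeasurableSpace E] [BorelSpace E]
        (Y : MarkovProcess Ω E) (μ : Measure E) [IsProbabilityMeasure μ],
        Y.IsInvariant μ →
        ∀ η : ℝ≥0 → ℝ≥0, Y.Decay μ η →
        ∀ α : ℝ≥0 → ℝ,
          (α = strongMixing Y.X (Y.lawFrom μ) ∨
            α = (fun r => Real.sqrt (η r)) ∨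
            (Y.IsSymmetric μ ∧ α = fun r => (η (r / 2) : ℝ))) →
          FiniteMixingMoment k α →
          ∀ V : E → ℝ, Measurable V → IsLUB (Set.range fun x => |V x|) 1 →
          ∀ R t : ℝ, 0 < R → R ≤ 1 → 0 < t → t * (1 - R) < ⌊t⌋₊ →
            (Y.lawFrom μ).real
                {ω | R ≤ 1 / t * (∫ s in (0 : ℝ)..t, V (Y.X s.toNNReal ω)) - ∫ x, V x ∂μ}
              ≤ C * mixingMoment k α / (t ^ k * (R - (1 - ⌊t⌋₊ / t)) ^ (2 * k)) := by
  refine ⟨deviationConst k, deviationConst_pos k, ?_⟩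
  intro Ω E _ _ _ _ _ Y μ _ hμ η hη α hα hM V hV hV1 R t _ _ ht hRt
  obtain ⟨hpos, hle⟩ := sub_one_sub_floor_div_mem_Ioc ht hRt
  refine (measureReal_mono fun ω hω => hle.trans (hω.trans (le_abs_self _))).trans ?_
  exact mainTheorem6_general hk Y.measurable_uncurry (Y.map_X_lawFrom hμ)
    (Y.strongMixing_le_of_decay hμ hη hα) hM hV (fun x => hV1.1 ⟨x, rfl⟩) hpos ht
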